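/- **Setting.** A sutured surface is a compact oriented surface $F$ with a finite set $\Lambda\subset\partial F$ having an even number of points on each boundary component, a labelling of the components of $\partial F\setminus\Lambda$ as belonging to $S_+$ or $S_-$, alternating across the points of $\Lambda$, and a labelling of each component of $S_+$ as incoming or outgoing, the incoming and the outgoing components each being ordered. Write $h=\operatorname{rk}H_1(F,S_+;\mathbb Z)$. For $A=(A_1,\dots,A_4)\in\mathbb Q^4$ and $N=(N_1,\dots,N_4)\in(\mathbb Z/2)^4$ put $$\delta(F)=-A_1h+(A_1-1)\,a_++A_2\,a_-+A_3\,c+\tfrac{A_1-1}{2}\,\iota+A_4\,o\in\mathbb Q,$$ $$\pi(F)=h+N_1\,a_-+N_2\,c+N_3\,\iota+N_4\,o\in\mathbb Z/2,$$ where $a_\pm$ is the number of non-closed components of $F$ not meeting $S_\pm$, $c$ is the number of closed components of $F$, and $\iota$ and $o$ are the numbers of interval and of circle components of $S_+$. Let $$\mathbf Z^{S_+}_{\delta,\pi}(F)=(\mathbb Z^{0|1})^{\otimes\pi(F)}\otimes\wedge^*H_1(F,S_+;\mathbb Z),$$ with $\pi(F)$ in the exponent read in $\{0,1\}$ and $\varepsilon_F$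 the standard basis element of the prefactor; $\varepsilon_F\otimes\wedge^k H_1(F,S_+;\mathbb Z)$ has degree $k+\delta(F)\in\mathbb Q$ and parity $k+\pi(F)$. For an interval component $I$ of $S_+$ let $\phi_I\colon H_1(F,S_+;\mathbb Z)\xrightarrow{\partial}H_0(S_+;\mathbb Z)\xrightarrow{[I]^*}\mathbb Z$. The algebra $\mathbb Z[E]/(E^2)$, with $E$ odd of degree $-1$, acts as follows: if $I$ is outgoing, on the left by $$E_I\,(\varepsilon_F\otimes v_1\wedge\dots\wedge v_k)=(-1)^{\pi(F)}\sum_{i=1}^k(-1)^{i-1}\phi_I(v_i)\,\varepsilon_F\otimes v_1\wedge\dots\widehat{v_i}\dots\wedge v_k;$$ if $I$ is incoming, on the right by $$(\varepsilon_F\otimes v_1\wedge\dots\wedge v_k)\,E_I=\sum_{i=1}^k(-1)^{k-i}\phi_I(v_i)\,\varepsilon_F\otimes v_1\wedge\dots\widehat{v_i}\dots\wedge v_k.$$ If all components of $S_+$ are intervals, $m$ of them incoming and $n$ outgoing, this is a left action of $(\mathbb Z[E]/(E^2))^{\otimes n}$ and a right action of $(\mathbb Z[E]/(E^2))^{\otimes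 m}$ (tensor products of superalgebras, so odd elements of different factors anticommute), the factors corresponding in order to the outgoing and the incoming components. For $p\ge0$, the open $p$-tuple of pants $\mathcal P$ is the closed disk with $2(p+1)$ sutures, hence $p+1$ intervals of $S_+$, one outgoing (on the left) and $p$ incoming (on the right, ordered from top to bottom, that is, clockwise starting from the outgoing one). For $1\le i\le p$ let $e_i\in H_1(\mathcal P,S_+;\mathbb Z)$ be the class of an arc between the outgoing interval and the $i$-th incoming interval, oriented from the outgoing to the incoming interval if $p-i$ is even and from the incoming to the outgoing interval if $p-i$ is odd. In $(\mathbb Z[E]/(E^2))^{\otimes p}$ let $E_j=1\otimes\dots\otimes1\otimes E\otimes1\otimes\dots\otimes1$ with $E$ in the $j$-th factor. **Proposition.** Let $A_1=1$ and $N_3=0$, the other parameters being arbitrary. Then $e_1,\dots,e_p$ is a basis of $H_1(\mathcal P,S_+;\mathbb Z)$, and the identification $$\varepsilon_{\mathcal P}\otimes(e_{i_1}\wedge\dots\wedge e_{i_k})\ \longleftrightarrow\ E_{j_1}\cdots E_{j_{p-k}},$$ where $1\le i_1<\dots<i_k\le p$ and $j_1<\dots<j_{p-k}$ are the elements of $\{1,\dots,p\}\setminus\{i_1,\dots,i_k\}$,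 gives an isomorphism $$\mathbf Z^{S_+}_{\delta,\pi}(\mathcal P)\cong(\mathbb Z[E]/(E^2))^{\otimes p}$$ of abelian groups that preserves the $\mathbb Q$-degree and the parity and is an isomorphism of (left, right) bimodules over $\bigl(\mathbb Z[E]/(E^2),(\mathbb Z[E]/(E^2))^{\otimes p}\bigr)$. Here $(\mathbb Z[E]/(E^2))^{\otimes p}$ acts on itself on the right by multiplication, and $\mathbb Z[E]/(E^2)$ acts on it on the left by multiplication through the iterated coproduct $\mathbb Z[E]/(E^2)\to(\mathbb Z[E]/(E^2))^{\otimes p}$ obtained from $\Delta(E)=E\otimes1+1\otimes E$ (for $p=0$, through the counit $E\mapsto0$). -/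

import Mathlib

open scoped TensorProduct DirectSum Manifold ContDiff Topology

universe u v

noncomputable section

/-! ### The superalgebras `(R[E]/(E²))^{⊗p}` -/

/-- A `ℤ`-graded algebra over `R`, regarded as a superalgebra: the parity of a homogeneous element
is its degree modulo 2. -/
structure GrAlg (R : Type) [CommRing R] where
  carrier : Type
  [ring : Ring carrier]
  [algebra : Algebra R carrier]
  gr : ℤ → Submodule R carrier
  [graded : GradedAlgebra gr]

attribute [instance] GrAlg.ring GrAlg.algebra GrAlg.graded

namespace GrAlg
variable (R : Type) [CommRing R]

/-- The grading of the ground ring, concentrated in degree `0`. -/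
def unitGr (n : ℤ) : Submodule R R := if n = 0 then ⊤ else ⊥

/-- The grading of `R[E]/(E²)` (Mathlib's dual numbers, with `E = DualNumber.eps`): `1` has degree
`0` and `E` has degree `-1`, so `E` is odd. -/
def dualGr (n : ℤ) : Submodule R (DualNumber R) :=
  if n = 0 then Submodule.span R {1} else if n = -1 then Submodule.span R {DualNumber.eps} else ⊥

theorem dualGr_zero : dualGr R 0 = Submodule.span R {1} := by simp [dualGr]
theorem dualGr_neg_one : dualGr R (-1) = Submodule.span R {DualNumber.eps} := by simp [dualGr]

instance : SetLike.GradedMonoid (unitGr R) where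
  one_mem := by simp [unitGr]
  mul_mem i j a b ha hb := by
    simp only [unitGr] at *
    split_ifs at * <;> simp_all

instance : GradedAlgebra (unitGr R) where
  toDecomposition := DirectSum.Decomposition.ofLinearMap (unitGr R)
    (DirectSum.lof R ℤ (fun i => unitGr R i) 0 ∘ₗ
      LinearMap.codRestrict (unitGr R 0) LinearMap.id (by simp [unitGr]))
    (by ext; simp)
    (by
      ext i ⟨x, hx⟩ : 2
      by_cases h : i = 0
      · subst h
        simp; rfl
      · have : x = 0 := by simpa [unitGr, h] using hx
        subst this
        have : (⟨0, hx⟩ : unitGr R i) = 0 := rfl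
        rw [this]; simp)

instance : SetLike.GradedMonoid (dualGr R) where
  one_mem := by simp [dualGr, Submodule.mem_span_singleton_self]
  mul_mem i j a b ha hb := by
    simp only [dualGr] at *
    split_ifs at ha hb with h1 h2 h3 h4 h5 <;> first
      | (simp only [Submodule.mem_bot] at ha; subst ha; simp)
      | (simp only [Submodule.mem_bot] at hb; subst hb; simp)
      | (obtain ⟨r, rfl⟩ := Submodule.mem_span_singleton.1 ha
         obtain ⟨s, rfl⟩ := Submodule.mem_span_singleton.1 hb
         subst_vars
         simp [Submodule.smul_mem, Submodule.mem_span_singleton_self])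

/-- The degree `0` part. -/
def dualPart0 : DualNumber R →ₗ[R] dualGr R 0 :=
  LinearMap.codRestrict (dualGr R 0)
    (LinearMap.toSpanSingleton R (DualNumber R) 1 ∘ₗ TrivSqZeroExt.fstHom R R R) (by
      intro x
      rw [dualGr_zero]
      exact Submodule.smul_mem _ _ (Submodule.mem_span_singleton_self _))

/-- The degree `-1` part. -/
def dualPart1 : DualNumber R →ₗ[R] dualGr R (-1) :=
  LinearMap.codRestrict (dualGr R (-1))
    (LinearMap.toSpanSingleton R (DualNumber R) DualNumber.eps ∘ₗ TrivSqZeroExt.sndHom R R) (by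
      intro x
      rw [dualGr_neg_one]
      exact Submodule.smul_mem _ _ (Submodule.mem_span_singleton_self _))

instance : GradedAlgebra (dualGr R) where
  toDecomposition := DirectSum.Decomposition.ofLinearMap (dualGr R)
    (DirectSum.lof R ℤ (fun i => dualGr R i) 0 ∘ₗ dualPart0 R +
      DirectSum.lof R ℤ (fun i => dualGr R i) (-1) ∘ₗ dualPart1 R)
    (by ext <;> simp [dualPart0, dualPart1])
    (by
      ext i x : 2
      simp only [LinearMap.comp_apply, DirectSum.coeLinearMap_lof, LinearMap.add_apply,
        LinearMap.id_apply]
      obtain ⟨x, hx⟩ := x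
      dsimp only
      by_cases h : i = 0
      · subst h
        obtain ⟨r, rfl⟩ := Submodule.mem_span_singleton.1 (dualGr_zero R ▸ hx)
        rw [show dualPart0 R (r • 1) = ⟨r • 1, hx⟩ from Subtype.ext (by simp [dualPart0]),
          show dualPart1 R (r • 1) = 0 from Subtype.ext (by simp [dualPart1]), map_zero, add_zero]
      by_cases h : i = -1
      · subst h
        obtain ⟨r, rfl⟩ := Submodule.mem_span_singleton.1 (dualGr_neg_one R ▸ hx)
        rw [show dualPart0 R (r • DualNumber.eps) = 0 from Subtype.ext (by simp [dualPart0]),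
          show dualPart1 R (r • DualNumber.eps) = ⟨r • DualNumber.eps, hx⟩ from
            Subtype.ext (by simp [dualPart1]), map_zero, zero_add]
      · have : x = 0 := by simpa [dualGr, *] using hx
        subst this
        rw [show (⟨0, hx⟩ : dualGr R i) = 0 from rfl]
        simp)

variable {R}

section tensor
variable {A B : Type} [Ring A] [Ring B] [Algebra R A] [Algebra R B]
  (𝒜 : ℤ → Submodule R A) (ℬ : ℤ → Submodule R B) [GradedAlgebra 𝒜] [GradedAlgebra ℬ]

/-- The total grading of the super tensor product `𝒜 ᵍ⊗[R] ℬ`, whose multiplication is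
`(a ⊗ b)(a' ⊗ b') = (-1)^(|b||a'|) aa' ⊗ bb'`. -/
def tensorGr (n : ℤ) : Submodule R (𝒜 ᵍ⊗[R] ℬ) :=
  Submodule.span R {x | ∃ i j : ℤ, i + j = n ∧ ∃ a ∈ 𝒜 i, ∃ b ∈ ℬ j, x = a ᵍ⊗ₜ[R] b}

theorem tmul_mem_tensorGr {i j n : ℤ} (h : i + j = n) {a : A}
    {b : B} (ha : a ∈ 𝒜 i) (hb : b ∈ ℬ j) :
    (a ᵍ⊗ₜ[R] b : 𝒜 ᵍ⊗[R] ℬ) ∈ tensorGr 𝒜 ℬ n :=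
  Submodule.subset_span ⟨i, j, h, a, ha, b, hb, rfl⟩

instance : SetLike.GradedMonoid (tensorGr 𝒜 ℬ) where
  one_mem := tmul_mem_tensorGr 𝒜 ℬ (zero_add 0) SetLike.GradedOne.one_mem SetLike.GradedOne.one_mem
  mul_mem m n x y hx hy := by
    induction hx using Submodule.span_induction with
    | zero => simp
    | add u v _ _ hu hv => rw [add_mul]; exact add_mem hu hv
    | smul r u _ hu => rw [GradedTensorProduct.mul_def, LinearMap.map_smul₂]; exact Submodule.smul_mem _ r hu
    | mem u hu =>
    obtain ⟨i, j, hij, a, ha, b, hb, rfl⟩ := hu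
    induction hy using Submodule.span_induction with
    | zero => simp
    | add u v _ _ hu hv => rw [mul_add]; exact add_mem hu hv
    | smul r u _ hu => rw [GradedTensorProduct.mul_def, map_smul]; exact Submodule.smul_mem _ r hu
    | mem u hu =>
    obtain ⟨k, l, hkl, c, hc, d, hd, rfl⟩ := hu
    have := GradedTensorProduct.tmul_coe_mul_coe_tmul 𝒜 ℬ a ⟨b, hb⟩ ⟨c, hc⟩ d
    dsimp only at this
    rw [this, Units.smul_def]
    refine zsmul_mem (tmul_mem_tensorGr 𝒜 ℬ (i := i + k) (j := j + l) (by omega)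
      (SetLike.GradedMul.mul_mem ha hc) (SetLike.GradedMul.mul_mem hb hd)) _

/-- The decomposition of the super tensor product into homogeneous parts. -/
def tensorDecompose : (𝒜 ᵍ⊗[R] ℬ) →ₗ[R] ⨁ n, tensorGr 𝒜 ℬ n :=
  (TensorProduct.lift
    (DirectSum.toModule R ℤ _ fun i =>
      LinearMap.flip (DirectSum.toModule R ℤ _ fun j => LinearMap.mk₂ R
        (fun (b : ℬ j) (a : 𝒜 i) => DirectSum.lof R ℤ (fun n => tensorGr 𝒜 ℬ n) (i + j)
          ⟨(a : A) ᵍ⊗ₜ[R] (b : B), tmul_mem_tensorGr 𝒜 ℬ rfl a.2 b.2⟩)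
        (fun b b' a => by
          rw [← map_add]; congr 1; ext
          exact congrArg (GradedTensorProduct.of R 𝒜 ℬ) (TensorProduct.tmul_add _ _ _))
        (fun r b a => by
          rw [← map_smul]; congr 1; ext
          exact congrArg (GradedTensorProduct.of R 𝒜 ℬ) (TensorProduct.tmul_smul _ _ _))
        (fun b a a' => by
          rw [← map_add]; congr 1; ext
          exact congrArg (GradedTensorProduct.of R 𝒜 ℬ) (TensorProduct.add_tmul _ _ _))
        (fun r b a => by
          rw [← map_smul]; congr 1)))) ∘ₗ
    (GradedTensorProduct.auxEquiv R 𝒜 ℬ).toLinearMap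

theorem tensorDecompose_tmul {i j n : ℤ} (h : i + j = n) {a : A}
    {b : B} (ha : a ∈ 𝒜 i) (hb : b ∈ ℬ j) :
    tensorDecompose 𝒜 ℬ (a ᵍ⊗ₜ[R] b) = DirectSum.lof R ℤ (fun n => tensorGr 𝒜 ℬ n) n
      ⟨a ᵍ⊗ₜ[R] b, tmul_mem_tensorGr 𝒜 ℬ h ha hb⟩ := by
  subst h
  simp only [tensorDecompose, LinearMap.comp_apply, LinearEquiv.coe_coe]
  rw [GradedTensorProduct.auxEquiv_tmul, DirectSum.decompose_of_mem _ ha,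
    DirectSum.decompose_of_mem _ hb, ← DirectSum.lof_eq_of R, ← DirectSum.lof_eq_of R]
  simp [DirectSum.toModule_lof]

instance : GradedAlgebra (tensorGr 𝒜 ℬ) where
  toDecomposition := DirectSum.Decomposition.ofLinearMap (tensorGr 𝒜 ℬ) (tensorDecompose 𝒜 ℬ)
    (by
      ext : 2
      refine DirectSum.decompose_lhom_ext 𝒜 fun i => ?_
      ext a : 1
      refine DirectSum.decompose_lhom_ext ℬ fun j => ?_
      ext b : 1
      have := tensorDecompose_tmul 𝒜 ℬ rfl a.2 b.2
      simp [this])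
    (by
      ext n ⟨x, hx⟩ : 2
      simp only [LinearMap.comp_apply, DirectSum.coeLinearMap_lof, LinearMap.id_apply]
      have : ∃ h : x ∈ tensorGr 𝒜 ℬ n, tensorDecompose 𝒜 ℬ x =
          DirectSum.lof R ℤ (fun n => tensorGr 𝒜 ℬ n) n ⟨x, h⟩ := by
        induction hx using Submodule.span_induction with
        | mem u hu =>
          obtain ⟨i, j, hij, a, ha, b, hb, rfl⟩ := hu
          exact ⟨_, tensorDecompose_tmul 𝒜 ℬ hij ha hb⟩
        | zero => exact ⟨zero_mem _, by
            rw [map_zero]; exact (map_zero (DirectSum.lof R ℤ (fun n => tensorGr 𝒜 ℬ n) n)).symm⟩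
        | add u v _ _ hu hv =>
          obtain ⟨hu, hu'⟩ := hu
          obtain ⟨hv, hv'⟩ := hv
          exact ⟨add_mem hu hv, by rw [map_add, hu', hv', ← map_add]; rfl⟩
        | smul r u _ hu =>
          obtain ⟨hu, hu'⟩ := hu
          exact ⟨Submodule.smul_mem _ r hu, by rw [map_smul, hu', ← map_smul]; rfl⟩
      exact this.2)

end tensor

variable (R) in
/-- The `p`-fold super tensor power `(R[E]/(E²))^{⊗p} = R[E]/(E²) ⊗ (R[E]/(E²) ⊗ (⋯ ⊗ R))`. -/
def dualPow : ℕ → GrAlg R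
  | 0 => { carrier := R, gr := unitGr R }
  | p + 1 => { carrier := dualGr R ᵍ⊗[R] (dualPow p).gr, gr := tensorGr (dualGr R) (dualPow p).gr }

/-- The algebra homomorphism `a ↦ 1 ⊗ ⋯ ⊗ 1 ⊗ a ⊗ 1 ⊗ ⋯ ⊗ 1`, with `a` in the
`i`-th factor. -/
def incl : (p : ℕ) → Fin p → (DualNumber R →ₐ[R] (dualPow R p).carrier)
  | 0, i => i.elim0
  | p + 1, i => Fin.cases (GradedTensorProduct.includeLeft (dualGr R) (dualPow R p).gr)
      (fun j => (GradedTensorProduct.includeRight (dualGr R) (dualPow R p).gr).comp (incl p j)) i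

theorem eps_mem_dualGr : (DualNumber.eps : DualNumber R) ∈ dualGr R (-1) := by
  rw [dualGr_neg_one]; exact Submodule.mem_span_singleton_self _

/-- The algebra homomorphism `R[E]/(E²) → C` sending `E` to an element `u` with `u² = 0`. -/
def dualLift {C : Type*} [Ring C] [Algebra R C] (u : C) (hu : u * u = 0) :
    DualNumber R →ₐ[R] C :=
  DualNumber.lift ⟨(Algebra.ofId R C, u), hu, fun a => (Algebra.commutes a u).symm⟩

theorem dualLift_eps {C : Type*} [Ring C] [Algebra R C] (u : C) (hu : u * u = 0) :
    dualLift (R := R) u hu DualNumber.eps = u := by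
  simp [dualLift]

theorem dualLift_apply {C : Type*} [Ring C] [Algebra R C] (u : C) (hu : u * u = 0)
    (a : DualNumber R) : dualLift u hu a = a.fst • 1 + a.snd • u := by
  have ha : a = a.fst • 1 + a.snd • DualNumber.eps := by ext <;> simp
  conv_lhs => rw [ha]
  rw [map_add, map_smul, map_smul, map_one, dualLift_eps]

/-- The coproduct `Δ(E) = E ⊗ 1 + 1 ⊗ E`. -/
def coproduct : DualNumber R →ₐ[R] (dualGr R) ᵍ⊗[R] (dualGr R) :=
  dualLift ((DualNumber.eps : DualNumber R) ᵍ⊗ₜ[R] (1 : DualNumber R) +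
      (1 : DualNumber R) ᵍ⊗ₜ[R] (DualNumber.eps : DualNumber R)) (by
    have h1 := GradedTensorProduct.tmul_one_mul_one_tmul (dualGr R) (dualGr R)
      (DualNumber.eps : DualNumber R) (DualNumber.eps : DualNumber R)
    have h2 := GradedTensorProduct.tmul_coe_mul_coe_tmul (dualGr R) (dualGr R)
      (1 : DualNumber R) ⟨DualNumber.eps, eps_mem_dualGr⟩ ⟨DualNumber.eps, eps_mem_dualGr⟩
      (1 : DualNumber R)
    have h3 := GradedTensorProduct.tmul_one_mul_coe_tmul (dualGr R) (dualGr R)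
      (DualNumber.eps : DualNumber R) ⟨DualNumber.eps, eps_mem_dualGr⟩ (1 : DualNumber R)
    have h4 := GradedTensorProduct.tmul_coe_mul_one_tmul (dualGr R) (dualGr R)
      (1 : DualNumber R) ⟨DualNumber.eps, eps_mem_dualGr⟩ (DualNumber.eps : DualNumber R)
    dsimp only at h1 h2 h3 h4
    rw [add_mul, mul_add, mul_add, h1, h2, h3, h4, DualNumber.eps_mul_eps]
    simp [GradedTensorProduct.tmul])

/-- The iterated coproduct `R[E]/(E²) → (R[E]/(E²))^{⊗p}`: the counit `E ↦ 0` for `p = 0`, and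
`(id ⊗ Δ^{(p)}) ∘ Δ` for `p + 1`. -/
def iterCoproduct : (p : ℕ) → (DualNumber R →ₗ[R] (dualPow R p).carrier)
  | 0 => (TrivSqZeroExt.fstHom R R R).toLinearMap
  | p + 1 =>
    (GradedTensorProduct.of R (dualGr R) (dualPow R p).gr).toLinearMap ∘ₗ
      TensorProduct.map LinearMap.id (iterCoproduct p) ∘ₗ
        (GradedTensorProduct.of R (dualGr R) (dualGr R)).symm.toLinearMap ∘ₗ
          coproduct.toLinearMap

section lift
variable {B C : Type*} [Ring B] [Algebra R B] [Ring C] [Algebra R C]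

theorem dualLift_comm (u : C) (hu : u * u = 0) (v : C) (hv : v * u = -(u * v))
    (n : ℤ) (a : DualNumber R) (ha : a ∈ dualGr R n) :
    v * dualLift u hu a = (-1 : ℤˣ) ^ n • (dualLift u hu a * v) := by
  by_cases hn : n = 0
  · subst hn
    obtain ⟨r, rfl⟩ := Submodule.mem_span_singleton.1 (dualGr_zero R ▸ ha)
    simp
  by_cases hn' : n = -1
  · subst hn'
    obtain ⟨r, rfl⟩ := Submodule.mem_span_singleton.1 (dualGr_neg_one R ▸ ha)
    simp [dualLift_eps, hv]
  · have : a = 0 := by simpa [dualGr, *] using ha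
    simp [this]

theorem dualLift_comm' (ℬ : ℤ → Submodule R B) (g : B →ₐ[R] C) (u : C) (hu : u * u = 0)
    (hg : ∀ (n : ℤ), ∀ b ∈ ℬ n, u * g b = (-1 : ℤˣ) ^ n • (g b * u))
    ⦃i j : ℤ⦄ (a : dualGr R i) (b : ℬ j) :
    dualLift u hu a.1 * g b = (-1 : ℤˣ) ^ (j * i) • (g b * dualLift u hu a.1) := by
  obtain ⟨a, ha⟩ := a
  obtain ⟨b, hb⟩ := b
  have hu := hg j b hb
  dsimp only
  by_cases hn : i = 0
  · subst hn
    obtain ⟨r, rfl⟩ := Submodule.mem_span_singleton.1 (dualGr_zero R ▸ ha)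
    simp
  by_cases hn' : i = -1
  · subst hn'
    obtain ⟨r, rfl⟩ := Submodule.mem_span_singleton.1 (dualGr_neg_one R ▸ ha)
    rw [map_smul, dualLift_eps, smul_mul_assoc, mul_smul_comm, hu, mul_neg_one, uzpow_neg,
      Int.units_inv_eq_self, smul_comm]
  · have : a = 0 := by simpa [dualGr, *] using ha
    simp [this]

theorem lift_comm {B : Type} [Ring B] [Algebra R B] (ℬ : ℤ → Submodule R B) [GradedAlgebra ℬ]
    (f : DualNumber R →ₐ[R] C) (g : B →ₐ[R] C)
    (h : ∀ ⦃i j : ℤ⦄ (a : dualGr R i) (b : ℬ j), f a * g b = (-1 : ℤˣ) ^ (j * i) • (g b * f a))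
    (v : C) (hf : ∀ (n : ℤ), ∀ a ∈ dualGr R n, v * f a = (-1 : ℤˣ) ^ n • (f a * v))
    (hg : ∀ (n : ℤ), ∀ b ∈ ℬ n, v * g b = (-1 : ℤˣ) ^ n • (g b * v))
    (n : ℤ) (x : dualGr R ᵍ⊗[R] ℬ) (hx : x ∈ tensorGr (dualGr R) ℬ n) :
    v * GradedTensorProduct.lift (dualGr R) ℬ f g h x =
      (-1 : ℤˣ) ^ n • (GradedTensorProduct.lift (dualGr R) ℬ f g h x * v) := by
  induction hx using Submodule.span_induction with
  | zero => simp
  | add x y _ _ hx hy => rw [map_add, mul_add, add_mul, smul_add, hx, hy]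
  | smul r x _ hx =>
    erw [map_smul]
    rw [mul_smul_comm, hx, smul_mul_assoc, smul_comm]
  | mem x hx =>
    obtain ⟨i, j, rfl, a, ha, b, hb, rfl⟩ := hx
    rw [GradedTensorProduct.lift_tmul, ← mul_assoc, hf i a ha, smul_mul_assoc, mul_assoc,
      hg j b hb, mul_smul_comm, smul_smul, uzpow_add, mul_assoc]

/-- Auxiliary recursion for `powLift`. -/
def powLiftAux : (p : ℕ) → (u : Fin p → C) →
    (∀ i, u i * u i = 0) → (∀ i j, u i * u j = -(u j * u i)) →
    {f : (dualPow R p).carrier →ₐ[R] C // ∀ v : C, (∀ i, v * u i = -(u i * v)) →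
      ∀ (n : ℤ), ∀ b ∈ (dualPow R p).gr n, v * f b = (-1 : ℤˣ) ^ n • (f b * v)}
  | 0, _, _, _ => ⟨Algebra.ofId R C, by
      intro v _ n (b : R) (hb : b ∈ unitGr R n)
      change v * algebraMap R C b = (-1 : ℤˣ) ^ n • (algebraMap R C b * v)
      by_cases h : n = 0
      · subst h
        simp only [uzpow_zero, one_smul]
        exact (Algebra.commutes b v).symm
      · have : b = 0 := by simpa [unitGr, h] using hb
        simp [this]⟩
  | p + 1, u, h0, h1 =>
    let g := powLiftAux p (fun i => u i.succ) (fun i => h0 _) (fun i j => h1 _ _)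
    have h := dualLift_comm' (dualPow R p).gr g.1 (u 0) (h0 0) (g.2 (u 0) (fun i => h1 _ _))
    ⟨GradedTensorProduct.lift (dualGr R) (dualPow R p).gr (dualLift (u 0) (h0 0)) g.1 h,
      fun v hv => lift_comm (dualPow R p).gr _ g.1 h v (dualLift_comm _ _ v (hv 0))
        (g.2 v fun i => hv i.succ)⟩

/-- The universal property of the super tensor power: pairwise anticommuting elements `u i` of
square zero define an algebra homomorphism sending `E` in the `i`-th factor to `u i`. -/
def powLift (p : ℕ) (u : Fin p → C) (h0 : ∀ i, u i * u i = 0)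
    (h1 : ∀ i j, u i * u j = -(u j * u i)) : (dualPow R p).carrier →ₐ[R] C :=
  (powLiftAux p u h0 h1).1

theorem powLift_incl : (p : ℕ) → (u : Fin p → C) → (h0 : ∀ i, u i * u i = 0) →
    (h1 : ∀ i j, u i * u j = -(u j * u i)) → (i : Fin p) →
    powLift (R := R) p u h0 h1 (incl p i DualNumber.eps) = u i
  | 0, _, _, _, i => i.elim0
  | p + 1, u, h0, h1, i => by
    refine Fin.cases ?_ (fun j => ?_) i
    · change dualLift (u 0) (h0 0) DualNumber.eps *
        powLift p (fun i => u i.succ) (fun i => h0 _) (fun i j => h1 _ _) 1 = u 0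
      rw [map_one, mul_one, dualLift_eps]
    · change dualLift (u 0) (h0 0) 1 * powLift p (fun i => u i.succ) (fun i => h0 _)
        (fun i j => h1 _ _) (incl p j DualNumber.eps) = u j.succ
      rw [map_one, one_mul, powLift_incl]

end lift

variable (R) in
/-- The element `E_i = 1 ⊗ ⋯ ⊗ E ⊗ ⋯ ⊗ 1`, with `E` in the `i`-th factor. -/
def E (p : ℕ) (i : Fin p) : (dualPow R p).carrier := incl p i DualNumber.eps

variable (R) in
/-- The product of the `E_j`, `j ∈ s`, in increasing order of `j`. -/
def prodE (p : ℕ) (s : Finset (Fin p)) : (dualPow R p).carrier :=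
  ((s.sort (· ≤ ·)).map (E R p)).prod

/-- The part of `ℚ`-degree `q` and parity `a`. -/
def superGr (B : GrAlg R) (q : ℚ) (a : ZMod 2) : Submodule R B.carrier :=
  ⨆ (n : ℤ) (_ : (n : ℚ) = q ∧ (n : ZMod 2) = a), B.gr n

end GrAlg

/-! ### Relative singular homology in degree one -/

namespace SingularRel

variable (R : Type) [CommRing R] {X : Type u} [TopologicalSpace X]

/-- Singular `n`-simplices in `X`. -/
abbrev Simplex (n : ℕ) (X : Type u) [TopologicalSpace X] : Type u :=
  C(stdSimplex ℝ (Fin (n + 1)), X)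

/-- Singular `n`-chains with coefficients in `R`. -/
abbrev Chain (R : Type) [CommRing R] (n : ℕ) (X : Type u) [TopologicalSpace X] :
    Type u := Simplex n X →₀ R

/-- The `i`-th face of a singular simplex. -/
def face (n : ℕ) (i : Fin (n + 2)) (σ : Simplex (n + 1) X) : Simplex n X :=
  σ.comp ⟨stdSimplex.map i.succAbove, stdSimplex.continuous_map _⟩

/-- The singular boundary operator. -/
def boundary (n : ℕ) : Chain R (n + 1) X →ₗ[R] Chain R n X :=
  Finsupp.lsum R fun σ => ∑ i : Fin (n + 2), LinearMap.toSpanSingleton R _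
    (Finsupp.single (face n i σ) ((-1 : R) ^ (i : ℕ)))

/-- The chains of `X` lying in the subset `S`, that is, the image of `C_n(S)` in `C_n(X)`. -/
def chainsIn (n : ℕ) (S : Set X) : Submodule R (Chain R n X) :=
  Submodule.span R {c | ∃ σ : Simplex n X, Set.range σ ⊆ S ∧ c = Finsupp.single σ 1}

/-- Relative `1`-cycles of `(X, S)`: the `1`-chains of `X` whose boundary lies in `S`. -/
def relCycles (S : Set X) : Submodule R (Chain R 1 X) :=
  (chainsIn R 0 S).comap (boundary R 0)

/-- Relative `1`-boundaries of `(X, S)`: sums of a boundary in `X` and a chain in `S`. -/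
def relBoundaries (S : Set X) : Submodule R (Chain R 1 X) :=
  LinearMap.range (boundary (X := X) R 1) ⊔ chainsIn R 1 S

/-- Relative singular homology `H_1(X, S; R)`: relative cycles modulo relative boundaries. -/
abbrev H1 (S : Set X) : Type u := (relCycles R S).map (relBoundaries R S).mkQ

/-- Singular homology `H_0(S; R)`: `0`-chains in `S` modulo boundaries of `1`-chains in `S`. -/
abbrev H0 (S : Set X) : Type u :=
  (chainsIn R 0 S).map ((chainsIn R 1 S).map (boundary R 0)).mkQ

theorem boundary_single (n : ℕ) (σ : Simplex (n + 1) X) :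
    boundary R n (Finsupp.single σ 1) =
      ∑ i : Fin (n + 2), Finsupp.single (face n i σ) ((-1 : R) ^ (i : ℕ)) := by
  simp [boundary]

theorem face_face_eq (σ : Simplex 2 X) (i j : Fin 3) (k l : Fin 2)
    (h : i.succAbove (k.succAbove 0) = j.succAbove (l.succAbove 0)) :
    face 0 k (face 1 i σ) = face 0 l (face 1 j σ) := by
  ext t
  simp only [face, ContinuousMap.comp_apply, ContinuousMap.coe_mk, stdSimplex.map_comp_apply]
  congr 2
  funext m
  obtain rfl : m = 0 := Subsingleton.elim (α := Fin 1) m 0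
  exact h

theorem boundary_boundary (c : Chain R 2 X) : boundary R 0 (boundary R 1 c) = 0 := by
  have : boundary (X := X) R 0 ∘ₗ boundary R 1 = 0 := by
    ext1 σ
    ext1
    simp only [LinearMap.comp_apply, Finsupp.lsingle_apply, boundary_single, map_sum,
      LinearMap.zero_apply]
    have h (τ : Simplex 1 X) (n : R) : boundary R 0 (Finsupp.single τ n) =
        n • ∑ i : Fin 2, Finsupp.single (face 0 i τ) ((-1 : R) ^ (i : ℕ)) := by
      rw [← boundary_single, ← map_smul, Finsupp.smul_single, smul_eq_mul, mul_one]
    simp only [h]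
    rw [Fin.sum_univ_three]
    simp only [Fin.sum_univ_two]
    rw [face_face_eq σ 0 1 0 0 (by decide), face_face_eq σ 0 2 1 0 (by decide),
      face_face_eq σ 1 2 1 1 (by decide)]
    simp
    abel
  exact LinearMap.congr_fun this c

theorem face_range (n : ℕ) (i : Fin (n + 2)) (σ : Simplex (n + 1) X) :
    Set.range (face n i σ) ⊆ Set.range σ := by
  rintro _ ⟨x, rfl⟩
  exact ⟨_, rfl⟩

theorem relBoundaries_le (S : Set X) : relBoundaries R S ≤
    ((chainsIn R 1 S).map (boundary R 0)).comap (boundary R 0) := by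
  refine sup_le ?_ (fun c hc => ⟨c, hc, rfl⟩)
  rintro _ ⟨c, rfl⟩
  rw [Submodule.mem_comap, boundary_boundary]
  exact zero_mem _

/-- The connecting homomorphism `∂ : H_1(X, S) → H_0(S)`. -/
def connecting (S : Set X) : H1 R S →ₗ[R] H0 R S :=
  LinearMap.restrict (Submodule.mapQ _ _ (boundary R 0) (relBoundaries_le R S)) (by
    rintro _ ⟨c, hc, rfl⟩
    exact ⟨boundary R 0 c, hc, rfl⟩)

/-- The subset of `X` underlying a connected component of the subspace `S`. -/
def componentSet {S : Set X} (I : ConnectedComponents S) : Set X :=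
  {x | ∃ h : x ∈ S, ConnectedComponents.mk (⟨x, h⟩ : S) = I}

open Classical in
/-- The sum of the coefficients of the points lying in `T`. -/
def countIn (T : Set X) : Chain R 0 X →ₗ[R] R :=
  Finsupp.lsum R fun σ => LinearMap.toSpanSingleton R R (if σ default ∈ T then 1 else 0)

theorem countIn_single (T : Set X) (σ : Simplex 0 X) [Decidable (σ default ∈ T)] (n : R) :
    countIn R T (Finsupp.single σ n) = if σ default ∈ T then n else 0 := by
  simp [countIn]

theorem countIn_boundary {S : Set X} (I : ConnectedComponents S) (c : Chain R 1 X)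
    (hc : c ∈ chainsIn R 1 S) : countIn R (componentSet I) (boundary R 0 c) = 0 := by
  classical
  induction hc using Submodule.span_induction with
  | zero => simp
  | add x y _ _ hx hy => rw [map_add, map_add, hx, hy, add_zero]
  | smul r x _ hx => rw [map_smul, map_smul, hx, smul_zero]
  | mem c hc =>
    obtain ⟨σ, hσ, rfl⟩ := hc
    rw [boundary_single, map_sum, Fin.sum_univ_two, countIn_single, countIn_single]
    have hS (t) : σ t ∈ S := hσ ⟨t, rfl⟩
    have key : ∀ s t : stdSimplex ℝ (Fin 2), σ s ∈ componentSet I → σ t ∈ componentSet I := by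
      rintro s t ⟨_, h⟩
      refine ⟨hS t, h ▸ ?_⟩
      have hcont : Continuous fun t : stdSimplex ℝ (Fin 2) => (⟨σ t, hS t⟩ : S) := by fun_prop
      have : PreconnectedSpace (stdSimplex ℝ (Fin 2)) :=
        stdSimplexHomeomorphUnitInterval.symm.surjective.denseRange.preconnectedSpace
          stdSimplexHomeomorphUnitInterval.symm.continuous
      exact ConnectedComponents.coe_eq_coe'.2
        ((isPreconnected_range hcont).subset_connectedComponent ⟨s, rfl⟩ ⟨t, rfl⟩)
    have : face 0 0 σ default ∈ componentSet I ↔ face 0 1 σ default ∈ componentSet I :=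
      ⟨key _ _, key _ _⟩
    simp [this]
    split_ifs <;> simp

/-- Evaluation on `H_0(S)` of the class `[I]^* ∈ H^0(S)` dual to a component `I` of `S`. -/
def dualClass {S : Set X} (I : ConnectedComponents S) : H0 R S →ₗ[R] R :=
  (Submodule.liftQ _ (countIn R (componentSet I)) (by
    rintro _ ⟨d, hd, rfl⟩
    exact countIn_boundary R I d hd)) ∘ₗ Submodule.subtype _

/-- A path as a singular `1`-simplex; vertex `0` goes to the start and vertex `1` to the end. -/
def pathSimplex {x y : X} (γ : Path x y) : Simplex 1 X :=
  γ.toContinuousMap.comp ⟨stdSimplexHomeomorphUnitInterval, by fun_prop⟩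

theorem pathSimplex_mem {S : Set X} {x y : X} (γ : Path x y) (hx : x ∈ S) (hy : y ∈ S) :
    Finsupp.single (pathSimplex γ) (1 : R) ∈ relCycles R S := by
  change boundary R 0 _ ∈ chainsIn R 0 S
  rw [boundary_single, Fin.sum_univ_two]
  have key (z : X) (hz : z ∈ S) (i : Fin 2) (hi : face 0 i (pathSimplex γ) default = z) (n : R) :
      Finsupp.single (face 0 i (pathSimplex γ)) n ∈ chainsIn R 0 S := by
    rw [← mul_one n, ← smul_eq_mul, ← Finsupp.smul_single]
    refine Submodule.smul_mem _ _ (Submodule.subset_span ⟨_, ?_, rfl⟩)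
    rintro _ ⟨t, rfl⟩
    rw [Subsingleton.elim t default, hi]
    exact hz
  have hv : (default : stdSimplex ℝ (Fin 1)) = stdSimplex.vertex 0 := Subsingleton.elim _ _
  refine add_mem (key y hy 0 ?_ _) (key x hx 1 ?_ _)
  · rw [hv]
    simp [face, pathSimplex]
  · rw [hv]
    simp [face, pathSimplex]

/-- The class in `H_1(X, S)` of a path with endpoints in `S`. -/
def arcClass {S : Set X} {x y : X} (γ : Path x y) (hx : x ∈ S) (hy : y ∈ S) : H1 R S :=
  ⟨Submodule.Quotient.mk (Finsupp.single (pathSimplex γ) 1), _, pathSimplex_mem R γ hx hy, rfl⟩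

end SingularRel

/-! ### Exterior algebras with a parity prefactor -/

namespace ShiftedExt

variable (R : Type) [CommRing R] (k : ℕ) (M : Type u) [AddCommGroup M] [Module R M]

/-- The prefactor `(R^{0|1})^{⊗k}`; its parity is recorded in the gradings below. -/
def Prefactor : Type := ⨂[R]^k R

instance : AddCommGroup (Prefactor R k) := inferInstanceAs (AddCommGroup (⨂[R] _ : Fin k, R))

instance : Module R (Prefactor R k) := inferInstanceAs (Module R (⨂[R] _ : Fin k, R))

/-- `(R^{0|1})^{⊗k} ⊗ ⋀* M`. -/
abbrev _root_.ShiftedExt : Type u := Prefactor R k ⊗[R] ExteriorAlgebra R M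

/-- The standard basis element of the prefactor. -/
def ε : Prefactor R k := PiTensorProduct.tprod R fun _ : Fin k => (1 : R)

/-- The summand `(R^{0|1})^{⊗k} ⊗ ⋀^j M`. -/
def wedgePart (j : ℕ) : Submodule R (ShiftedExt R k M) :=
  LinearMap.range ((⋀[R]^j M).subtype.lTensor (Prefactor R k))

variable {M}

/-- The operator `ε ⊗ w ↦ (-1)^k ε ⊗ Φ(w)`, where
`Φ(v_1 ∧ ⋯ ∧ v_j) = ∑ i, (-1)^(i-1) d(v_i) v_1 ∧ ⋯ v̂_i ⋯ ∧ v_j`; see `contractLeft_ιMulti`. -/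
def outOp (d : Module.Dual R M) : Module.End R (ShiftedExt R k M) :=
  (-1 : R) ^ k •
    (CliffordAlgebra.contractLeft (Q := (0 : QuadraticForm R M)) d).lTensor (Prefactor R k)

/-- The operator `ε ⊗ w ↦ ε ⊗ Φ(w)`, where
`Φ(v_1 ∧ ⋯ ∧ v_j) = ∑ i, (-1)^(j-i) d(v_i) v_1 ∧ ⋯ v̂_i ⋯ ∧ v_j`; see `contractRight_ιMulti`. -/
def inOp (d : Module.Dual R M) : Module.End R (ShiftedExt R k M) :=
  ((CliffordAlgebra.contractRight (Q := (0 : QuadraticForm R M))).flip d).lTensor (Prefactor R k)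

theorem contractLeft_ιMulti (d : Module.Dual R M) : (j : ℕ) → (v : Fin (j + 1) → M) →
    CliffordAlgebra.contractLeft (Q := (0 : QuadraticForm R M)) d
        (ExteriorAlgebra.ιMulti R (j + 1) v) =
      ∑ i : Fin (j + 1), ((-1 : R) ^ (i : ℕ) * d (v i)) •
        ExteriorAlgebra.ιMulti R j (fun l => v (i.succAbove l))
  | 0, v => by
    simp [ExteriorAlgebra.ιMulti_apply, Algebra.algebraMap_eq_smul_one]
  | j + 1, v => by
    rw [ExteriorAlgebra.ιMulti_succ_apply]
    erw [CliffordAlgebra.contractLeft_ι_mul]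
    rw [contractLeft_ιMulti d j, Fin.sum_univ_succ (n := j + 1), sub_eq_add_neg, Finset.mul_sum,
      ← Finset.sum_neg_distrib]
    congr 1
    · simp; rfl
    · refine Finset.sum_congr rfl fun i _ => ?_
      rw [ExteriorAlgebra.ιMulti_succ_apply, mul_smul_comm, ← neg_smul]
      congr 1
      · simp [pow_succ, Matrix.vecTail]
      · have h0 : i.succ.succAbove 0 = 0 := Fin.succAbove_ne_zero_zero (Fin.succ_ne_zero i)
        have h1 : (fun l => Matrix.vecTail v (i.succAbove l)) =
            Matrix.vecTail fun l => v (i.succ.succAbove l) := by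
          funext l
          simp [Matrix.vecTail, Fin.succ_succAbove_succ]
        rw [h0, h1]

theorem contractRight_ιMulti (d : Module.Dual R M) : (j : ℕ) → (v : Fin (j + 1) → M) →
    CliffordAlgebra.contractRight (Q := (0 : QuadraticForm R M))
        (ExteriorAlgebra.ιMulti R (j + 1) v) d =
      ∑ i : Fin (j + 1), ((-1 : R) ^ (j - (i : ℕ)) * d (v i)) •
        ExteriorAlgebra.ιMulti R j (fun l => v (i.succAbove l))
  | 0, v => by
    simp [ExteriorAlgebra.ιMulti_apply, Algebra.algebraMap_eq_smul_one]
  | j + 1, v => by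
    have hs (l : ℕ) (u : Fin (l + 1) → M) : ExteriorAlgebra.ιMulti R (l + 1) u =
        ExteriorAlgebra.ιMulti R l (fun i => u i.castSucc) * ExteriorAlgebra.ι R (u (Fin.last l)) := by
      rw [ExteriorAlgebra.ιMulti_apply, ExteriorAlgebra.ιMulti_apply, List.ofFn_succ',
        List.concat_eq_append, List.prod_append, List.prod_singleton]
    rw [hs]
    erw [CliffordAlgebra.contractRight_mul_ι]
    rw [contractRight_ιMulti d j, Fin.sum_univ_castSucc (n := j + 1), sub_eq_add_neg, Finset.sum_mul,
      ← Finset.sum_neg_distrib, add_comm]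
    congr 1
    · refine Finset.sum_congr rfl fun i _ => ?_
      have hi : j + 1 - (i : ℕ) = j - i + 1 := by omega
      rw [hs, smul_mul_assoc, ← neg_smul]
      simp [hi, pow_succ]
    · simp

theorem outOp_anticomm (d d' : Module.Dual R M) :
    outOp R k d * outOp R k d' = -(outOp R k d' * outOp R k d) := by
  refine TensorProduct.ext' fun a w => ?_
  simp [outOp, CliffordAlgebra.contractLeft_comm d d', TensorProduct.tmul_neg]

theorem outOp_sq (d : Module.Dual R M) : outOp R k d * outOp R k d = 0 := by
  refine TensorProduct.ext' fun a w => ?_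
  simp [outOp, CliffordAlgebra.contractLeft_contractLeft]

theorem inOp_anticomm (d d' : Module.Dual R M) :
    inOp R k d * inOp R k d' = -(inOp R k d' * inOp R k d) := by
  refine TensorProduct.ext' fun a w => ?_
  simp [inOp, CliffordAlgebra.contractRight_comm d' d, TensorProduct.tmul_neg]

theorem inOp_sq (d : Module.Dual R M) : inOp R k d * inOp R k d = 0 := by
  refine TensorProduct.ext' fun a w => ?_
  simp [inOp, CliffordAlgebra.contractRight_contractRight]

/-- The left action of `(R[E]/(E²))^{⊗n}` in which the `i`-th `E` acts by `outOp (d i)`. -/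
def leftAction {n : ℕ} (d : Fin n → Module.Dual R M) :
    (GrAlg.dualPow R n).carrier →ₐ[R] Module.End R (ShiftedExt R k M) :=
  GrAlg.powLift n (fun i => outOp R k (d i)) (fun _ => outOp_sq R k _)
    (fun _ _ => outOp_anticomm R k _ _)

/-- The right action of `(R[E]/(E²))^{⊗n}` in which the `i`-th `E` acts by `inOp (d i)`. -/
def rightAction {n : ℕ} (d : Fin n → Module.Dual R M) :
    (GrAlg.dualPow R n).carrier →ₐ[R] (Module.End R (ShiftedExt R k M))ᵐᵒᵖ :=
  GrAlg.powLift n (fun i => MulOpposite.op (inOp R k (d i)))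
    (fun _ => by rw [← MulOpposite.op_mul, inOp_sq, MulOpposite.op_zero])
    (fun _ _ => by rw [← MulOpposite.op_mul, inOp_anticomm, MulOpposite.op_neg,
      MulOpposite.op_mul])

end ShiftedExt

open SingularRel

/-- A sutured surface `(F, Λ, S₊, S₋, ℓ)` whose `S₊` has `m` incoming and `n` outgoing components:
a cobordism from `m` to `n` components. -/
structure SuturedSurface (m n : ℕ) where
  /-- The underlying compact surface `F` with (possibly empty) boundary. -/
  carrier : Type u
  [top : TopologicalSpace carrier]
  [t2 : T2Space carrier]
  [compact : CompactSpace carrier]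
  [charted : ChartedSpace (EuclideanHalfSpace 2) carrier]
  [smooth : IsManifold (𝓡∂ 2) ∞ carrier]
  /-- The atlas is an oriented atlas: the coordinate changes have positive Jacobian determinant. -/
  oriented : ∀ e ∈ atlas (EuclideanHalfSpace 2) carrier,
    ∀ e' ∈ atlas (EuclideanHalfSpace 2) carrier, ∀ x ∈ e.source ∩ e'.source,
      0 < (fderivWithin ℝ ((𝓡∂ 2) ∘ e' ∘ e.symm ∘ (𝓡∂ 2).symm) (Set.range (𝓡∂ 2))
        ((𝓡∂ 2) (e x))).det
  /-- The sutures, an even number of points on each boundary component. -/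
  Λ : Set carrier
  Splus : Set carrier
  Sminus : Set carrier
  Λ_subset : Λ ⊆ (𝓡∂ 2).boundary carrier
  Λ_finite : Λ.Finite
  Λ_even : ∀ x ∈ (𝓡∂ 2).boundary carrier,
    Even (Λ ∩ connectedComponentIn ((𝓡∂ 2).boundary carrier) x).ncard
  /-- Every component of `∂F \ Λ` belongs to exactly one of `S₊` and `S₋`. -/
  disjoint : Disjoint Splus Sminus
  union : Splus ∪ Sminus = (𝓡∂ 2).boundary carrier \ Λ
  plus_component : ∀ x ∈ Splus,
    connectedComponentIn ((𝓡∂ 2).boundary carrier \ Λ) x ⊆ Splus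
  minus_component : ∀ x ∈ Sminus,
    connectedComponentIn ((𝓡∂ 2).boundary carrier \ Λ) x ⊆ Sminus
  /-- The labels alternate across the sutures. -/
  alternating : ∀ x ∈ Λ, x ∈ closure Splus ∧ x ∈ closure Sminus
  /-- The incoming components of `S₊`, in order. -/
  inc : Fin m → ConnectedComponents Splus
  /-- The outgoing components of `S₊`, in order. -/
  out : Fin n → ConnectedComponents Splus
  /-- Every component of `S₊` is listed exactly once, as incoming or as outgoing. -/
  label_bijective : Function.Bijective (Sum.elim inc out)

attribute [instance] SuturedSurface.top SuturedSurface.t2 SuturedSurface.compact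
  SuturedSurface.charted SuturedSurface.smooth

namespace SuturedSurface

variable (R : Type) [CommRing R] {m n : ℕ} (F : SuturedSurface.{u} m n)

/-- The boundary `∂F`. -/
abbrev bdry : Set F.carrier := (𝓡∂ 2).boundary F.carrier

/-- `H_1(F, S₊; R)`. -/
abbrev H : Type u := H1 R F.Splus

/-- The rank of `H_1(F, S₊; R)`. -/
def rankH : ℕ := Module.finrank R (F.H R)

/-- `h = rk H_1(F, S₊; ℤ)`. -/
abbrev h : ℕ := F.rankH ℤ

/-- The component `I` of `S₊` is an (open) interval. -/
def IsInterval (I : ConnectedComponents F.Splus) : Prop :=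
  Nonempty (componentSet I ≃ₜ Set.Ioo (0 : ℝ) 1)

/-- The component `I` of `S₊` is a circle. -/
def IsCircle (I : ConnectedComponents F.Splus) : Prop :=
  Nonempty (componentSet I ≃ₜ Circle)

/-- The connected component `C` of `F` meets `T`. -/
def Meets (C : ConnectedComponents F.carrier) (T : Set F.carrier) : Prop :=
  ∃ x ∈ T, ConnectedComponents.mk x = C

/-- The number of non-closed components of `F` without `S₊`. -/
def numNoPlus : ℕ := {C | F.Meets C F.bdry ∧ ¬ F.Meets C F.Splus}.ncard
/-- The number of non-closed components of `F` without `S₋`. -/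
def numNoMinus : ℕ := {C | F.Meets C F.bdry ∧ ¬ F.Meets C F.Sminus}.ncard
/-- The number of closed components of `F`. -/
def numClosed : ℕ := {C | ¬ F.Meets C F.bdry}.ncard
/-- The number of interval components of `S₊`. -/
def numIntervals : ℕ := {I | F.IsInterval I}.ncard
/-- The number of circle components of `S₊`. -/
def numCircles : ℕ := {I | F.IsCircle I}.ncard

/-- The degree shift `δ_{A₁,A₂,A₃,A₄}(F)`, with `A₁, A₂, A₃, A₄` written `A 0, A 1, A 2, A 3`. -/
def δ (A : Fin 4 → ℚ) : ℚ :=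
  -A 0 * F.h + (A 0 - 1) * F.numNoPlus + A 1 * F.numNoMinus + A 2 * F.numClosed +
    (A 0 - 1) / 2 * F.numIntervals + A 3 * F.numCircles

/-- The parity shift `π_{N₁,N₂,N₃,N₄}(F)`, with `N₁, N₂, N₃, N₄` written `N 0, N 1, N 2, N 3`. -/
def parity (N : Fin 4 → ZMod 2) : ZMod 2 :=
  F.h + N 0 * F.numNoMinus + N 1 * F.numClosed + N 2 * F.numIntervals + N 3 * F.numCircles

variable (N : Fin 4 → ZMod 2)

/-- The module `Z^{S₊}_{δ,π}(F) = (R^{0|1})^{⊗π(F)} ⊗ ⋀* H_1(F, S₊; R)`, without its gradings. -/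
abbrev Z : Type u := ShiftedExt R (F.parity N).val (F.H R)

/-- The element `ε_F ⊗ w`. -/
def pureTensor (w : ExteriorAlgebra R (F.H R)) : F.Z R N :=
  ShiftedExt.ε R (F.parity N).val ⊗ₜ[R] w

/-- The part of `Z^{S₊}_{δ,π}(F)` of `ℚ`-degree `q` and parity `a`: `⋀^k` sits in degree `k + δ(F)`
and has parity `k + π(F)`. -/
def gr (A : Fin 4 → ℚ) (q : ℚ) (a : ZMod 2) : Submodule R (F.Z R N) :=
  ⨆ (k : ℕ) (_ : (k : ℚ) + F.δ A = q ∧ (k : ZMod 2) + F.parity N = a),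
    ShiftedExt.wedgePart R (F.parity N).val (F.H R) k

/-- The map `φ_I : H_1(F, S₊) → H_0(S₊) → R`, the connecting map followed by `[I]^*`. -/
def φ (I : ConnectedComponents F.Splus) : Module.Dual R (F.H R) :=
  dualClass R I ∘ₗ connecting R F.Splus

/-- The left action on `Z^{S₊}_{δ,π}(F)` of one copy of `R[E]/(E²)` for each outgoing component of
`S₊`, for `F` all of whose outgoing components are intervals. -/
def lact (a : (GrAlg.dualPow R n).carrier) (z : F.Z R N) : F.Z R N :=
  ShiftedExt.leftAction R (F.parity N).val (fun i => F.φ R (F.out i)) a z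

/-- The right action on `Z^{S₊}_{δ,π}(F)` of one copy of `R[E]/(E²)` for each incoming component of
`S₊`, for `F` all of whose incoming components are intervals. -/
def ract (z : F.Z R N) (a : (GrAlg.dualPow R m).carrier) : F.Z R N :=
  (ShiftedExt.rightAction R (F.parity N).val (fun i => F.φ R (F.inc i)) a).unop z

/-- An isomorphism of sutured surfaces: an orientation-preserving diffeomorphism respecting
`Λ`, `S₊`, `S₋` and the ordered lists of incoming and outgoing components. -/
structure Iso (F : SuturedSurface.{u} m n) (G : SuturedSurface.{v} m n) where
  diffeo : Diffeomorph (𝓡∂ 2) (𝓡∂ 2) F.carrier G.carrier ∞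
  oriented : ∀ x, 0 < (mfderiv (𝓡∂ 2) (𝓡∂ 2) diffeo x :
    EuclideanSpace ℝ (Fin 2) →L[ℝ] EuclideanSpace ℝ (Fin 2)).det
  map_Λ : diffeo '' F.Λ = G.Λ
  map_plus : diffeo '' F.Splus = G.Splus
  map_minus : diffeo '' F.Sminus = G.Sminus
  map_inc : ∀ i, diffeo '' componentSet (F.inc i) = componentSet (G.inc i)
  map_out : ∀ i, diffeo '' componentSet (F.out i) = componentSet (G.out i)

end SuturedSurface

/-! ### The open `p`-tuple of pants -/

namespace Disk

/-- The closed unit disk in `ℂ`, made into an oriented smooth surface with boundary by the Cayley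
charts `z ↦ (1 + s z) / (1 - s z)`, `|s| = 1`, onto the closed right half-plane. -/
abbrev D : Type := Metric.closedBall (0 : ℂ) 1

/-- `ℂ` as `ℝ²`. -/
abbrev L : ℂ ≃L[ℝ] EuclideanSpace ℝ (Fin 2) :=
  Complex.orthonormalBasisOneI.repr.toContinuousLinearEquiv

theorem L_zero (w : ℂ) : L w 0 = w.re := by simp [L, Complex.orthonormalBasisOneI_repr_apply]
theorem L_symm_re (y : EuclideanSpace ℝ (Fin 2)) : (L.symm y).re = y 0 := by
  rw [← L_zero, L.apply_symm_apply]

theorem D_norm_le (z : D) : ‖(z : ℂ)‖ ≤ 1 := mem_closedBall_zero_iff.1 z.2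

theorem cayley_re (z : ℂ) : ((1 + z) / (1 - z)).re = (1 - ‖z‖ ^ 2) / ‖1 - z‖ ^ 2 := by
  rw [Complex.div_re, ← Complex.normSq_eq_norm_sq, ← Complex.normSq_eq_norm_sq]
  simp [Complex.normSq_apply]
  ring

theorem norm_smul (s : Circle) (z : D) : ‖(s : ℂ) * z‖ = ‖(z : ℂ)‖ := by
  rw [norm_mul, Circle.norm_coe, one_mul]

theorem cayley_re_nonneg (s : Circle) (z : D) :
    0 ≤ ((1 + (s : ℂ) * z) / (1 - (s : ℂ) * z)).re := by
  rw [cayley_re, norm_smul]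
  have := D_norm_le z
  have h0 := norm_nonneg (z : ℂ)
  exact div_nonneg (by nlinarith) (by positivity)

theorem add_one_ne_zero {w : ℂ} (h : 0 ≤ w.re) : w + 1 ≠ 0 := by
  intro h'
  have := congrArg Complex.re h'
  simp at this
  linarith

theorem inv_norm_le {w : ℂ} (h : 0 ≤ w.re) : ‖(w - 1) / (w + 1)‖ ≤ 1 := by
  rw [norm_div, div_le_one (norm_pos_iff.2 (add_one_ne_zero h))]
  rw [← sq_le_sq₀ (norm_nonneg _) (norm_nonneg _), ← Complex.normSq_eq_norm_sq,
    ← Complex.normSq_eq_norm_sq]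
  simp [Complex.normSq_apply]
  nlinarith

/-- The Cayley chart `z ↦ (1 + s z) / (1 - s z)`, defined away from `s⁻¹`. -/
def chart (s : Circle) : OpenPartialHomeomorph D (EuclideanHalfSpace 2) where
  toFun z := ⟨L ((1 + (s : ℂ) * z) / (1 - (s : ℂ) * z)), by
    rw [L_zero]; exact cayley_re_nonneg s z⟩
  invFun y := ⟨(s : ℂ)⁻¹ * ((L.symm y.1 - 1) / (L.symm y.1 + 1)), by
    have := inv_norm_le (w := L.symm y.1) (by rw [L_symm_re]; exact y.2)
    rw [mem_closedBall_zero_iff, norm_mul, norm_inv, Circle.norm_coe, inv_one, one_mul]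
    exact this⟩
  source := {z | (s : ℂ) * z ≠ 1}
  target := Set.univ
  map_source' := by simp
  map_target' := by
    intro y _
    have h := add_one_ne_zero (w := L.symm y.1) (by rw [L_symm_re]; exact y.2)
    simp only [Set.mem_ofPred_eq]
    rw [mul_inv_cancel_left₀ s.coe_ne_zero, Ne, div_eq_one_iff_eq h]
    intro h'
    have := congrArg Complex.re h'
    simp at this
    linarith
  left_inv' := by
    intro z hz
    have hz' : 1 - (s : ℂ) * z ≠ 0 := sub_ne_zero.2 (Ne.symm hz)
    have hs := s.coe_ne_zero
    ext
    simp only [ContinuousLinearEquiv.symm_apply_apply]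
    have : (1 + (s : ℂ) * z) / (1 - (s : ℂ) * z) + 1 = 2 / (1 - (s : ℂ) * z) := by
      field_simp; ring
    rw [this]
    field_simp
    ring
  right_inv' := by
    intro y _
    have h := add_one_ne_zero (w := L.symm y.1) (by rw [L_symm_re]; exact y.2)
    apply EuclideanHalfSpace.ext
    simp only
    rw [mul_inv_cancel_left₀ s.coe_ne_zero]
    rw [← ContinuousLinearEquiv.eq_symm_apply]
    field_simp
    ring
  open_source := by
    apply isOpen_ne_fun <;> fun_prop
  open_target := isOpen_univ
  continuousOn_toFun := by
    refine Topology.IsInducing.subtypeVal.continuousOn_iff.2 ?_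
    refine L.continuous.comp_continuousOn (ContinuousOn.div (by fun_prop) (by fun_prop) ?_)
    intro z hz
    exact sub_ne_zero.2 (Ne.symm hz)
  continuousOn_invFun := by
    apply Continuous.continuousOn
    apply Continuous.subtype_mk
    have hc : Continuous fun y : EuclideanHalfSpace 2 => L.symm y.1 :=
      L.symm.continuous.comp continuous_subtype_val
    refine continuous_const.mul (Continuous.div (hc.sub continuous_const)
      (hc.add continuous_const) ?_)
    intro y
    exact add_one_ne_zero (w := L.symm y.1) (by rw [L_symm_re]; exact y.2)

/-- The coordinate change between two charts, in complex coordinates. -/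
def trans (t w : ℂ) : ℂ := (1 + t * ((w - 1) / (w + 1))) / (1 - t * ((w - 1) / (w + 1)))

theorem trans_eq (s s' : Circle) :
    Set.EqOn ((𝓡∂ 2) ∘ chart s' ∘ (chart s).symm ∘ (𝓡∂ 2).symm)
      (L ∘ trans (s' * (s : ℂ)⁻¹) ∘ L.symm) (Set.range (𝓡∂ 2)) := by
  rintro _ ⟨y, rfl⟩
  simp only [Function.comp_apply, ModelWithCorners.left_inv]
  change L _ = L _
  congr 1
  simp only [trans, chart, mul_assoc]
  rfl

theorem trans_ne {s s' : Circle} {y : EuclideanHalfSpace 2}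
    (h : (chart s).symm y ∈ (chart s').source) :
    1 - (s' * (s : ℂ)⁻¹) * ((L.symm y.1 - 1) / (L.symm y.1 + 1)) ≠ 0 := by
  have h' : (s' : ℂ) * ((s : ℂ)⁻¹ * ((L.symm y.1 - 1) / (L.symm y.1 + 1))) ≠ 1 := h
  rw [mul_assoc]
  exact sub_ne_zero.2 (Ne.symm h')

theorem trans_hasDerivAt {t w : ℂ} (hw : w + 1 ≠ 0) (h : 1 - t * ((w - 1) / (w + 1)) ≠ 0) :
    HasDerivAt (trans t) (4 * t / ((1 - t * ((w - 1) / (w + 1))) * (w + 1)) ^ 2) w := by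
  have h1 : HasDerivAt (fun w : ℂ => (w - 1) / (w + 1)) (2 / (w + 1) ^ 2) w := by
    refine (((hasDerivAt_id w).sub_const 1).div ((hasDerivAt_id w).add_const 1) hw).congr_deriv ?_
    congr 1
    simp only [id]
    ring
  have h2 := h1.const_mul t
  refine ((h2.const_add 1).div (h2.const_sub 1) h).congr_deriv ?_
  have h3 : 1 + t * ((w - 1) / (w + 1)) = 2 - (1 - t * ((w - 1) / (w + 1))) := by ring
  rw [h3]
  generalize 1 - t * ((w - 1) / (w + 1)) = d at *
  generalize w + 1 = c at *
  field_simp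
  ring

theorem trans_contDiffAt {t w : ℂ} (hw : w + 1 ≠ 0) (h : 1 - t * ((w - 1) / (w + 1)) ≠ 0) :
    ContDiffAt ℝ ∞ (trans t) w := by
  have h1 : ContDiffAt ℂ ∞ (fun w : ℂ => (w - 1) / (w + 1)) w :=
    ContDiffAt.div (by fun_prop) (by fun_prop) hw
  have h2 : ContDiffAt ℂ ∞ (fun w : ℂ => t * ((w - 1) / (w + 1))) w := contDiffAt_const.mul h1
  exact ((contDiffAt_const.add h2).div (contDiffAt_const.sub h2) h).restrict_scalars ℝ

theorem det_smul_pos {a : ℂ} (ha : a ≠ 0) :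
    0 < ((L.toContinuousLinearMap ∘L (a • (1 : ℂ →L[ℝ] ℂ)) ∘L L.symm.toContinuousLinearMap :
      EuclideanSpace ℝ (Fin 2) →L[ℝ] EuclideanSpace ℝ (Fin 2))).det := by
  have h : LinearMap.det (LinearMap.mul ℝ ℂ a) = Complex.normSq a := by
    rw [← Algebra.norm_complex_apply]; rfl
  have h2 := LinearMap.det_conj (LinearMap.mul ℝ ℂ a) L.toLinearEquiv
  rw [h] at h2
  refine (Complex.normSq_pos.2 ha).trans_eq ?_
  rw [← h2]
  rfl

theorem chart_oriented (s s' : Circle) (x : D) (hx : x ∈ (chart s).source ∩ (chart s').source) :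
    0 < (fderivWithin ℝ ((𝓡∂ 2) ∘ chart s' ∘ (chart s).symm ∘ (𝓡∂ 2).symm) (Set.range (𝓡∂ 2))
        ((𝓡∂ 2) (chart s x))).det := by
  have hw := add_one_ne_zero (w := L.symm (chart s x).1) (by rw [L_symm_re]; exact (chart s x).2)
  have hd := trans_ne (s := s) (s' := s') (y := chart s x)
    (by rw [(chart s).left_inv hx.1]; exact hx.2)
  have hmem : (𝓡∂ 2) (chart s x) ∈ Set.range (𝓡∂ 2) := ⟨_, rfl⟩
  rw [fderivWithin_congr (trans_eq s s') (trans_eq s s' hmem)]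
  have h1 := (trans_hasDerivAt hw hd).complexToReal_fderiv
  have h2 : HasFDerivAt (L ∘ trans (s' * (s : ℂ)⁻¹) ∘ L.symm) _ ((𝓡∂ 2) (chart s x)) :=
    L.hasFDerivAt.comp _ (h1.comp _ L.symm.hasFDerivAt)
  rw [h2.hasFDerivWithinAt.fderivWithin ((𝓡∂ 2).uniqueDiffOn _ hmem)]
  apply det_smul_pos
  refine div_ne_zero (mul_ne_zero (by norm_num) ?_) (pow_ne_zero _ (mul_ne_zero hd hw))
  exact mul_ne_zero s'.coe_ne_zero (inv_ne_zero s.coe_ne_zero)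

open Classical in
instance : ChartedSpace (EuclideanHalfSpace 2) D where
  atlas := Set.range chart
  chartAt z := if (z : ℂ) = 1 then chart (Circle.exp Real.pi) else chart 1
  mem_chart_source z := by
    split_ifs with h
    · simp [chart, h]; norm_num
    · simpa [chart] using h
  chart_mem_atlas z := by split_ifs <;> exact ⟨_, rfl⟩

instance : IsManifold (𝓡∂ 2) ∞ D := by
  refine isManifold_of_contDiffOn _ _ _ ?_
  rintro _ _ ⟨s, rfl⟩ ⟨s', rfl⟩
  rintro _ ⟨hy, y, rfl⟩
  simp only [Set.mem_preimage, ModelWithCorners.left_inv] at hy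
  have hw := add_one_ne_zero (w := L.symm y.1) (by rw [L_symm_re]; exact y.2)
  have hd := trans_ne (s := s) (s' := s') (y := y) hy.2
  have h1 : ContDiffAt ℝ ∞ (L ∘ trans (s' * (s : ℂ)⁻¹) ∘ L.symm) ((𝓡∂ 2) y) :=
    L.contDiff.contDiffAt.comp _
      (ContDiffAt.comp _ (trans_contDiffAt hw hd) L.symm.contDiff.contDiffAt)
  refine h1.contDiffWithinAt.congr (fun z hz => trans_eq s s' hz.2) (trans_eq s s' ⟨y, rfl⟩)

theorem boundary_eq : (𝓡∂ 2).boundary D = {z : D | ‖(z : ℂ)‖ = 1} := by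
  have key (s : Circle) (z : D) (hz : (s : ℂ) * z ≠ 1) :
      (𝓡∂ 2) (chart s z) ∈ frontier (Set.range (𝓡∂ 2)) ↔ ‖(z : ℂ)‖ = 1 := by
    rw [frontier_range_modelWithCornersEuclideanHalfSpace]
    change 0 = L _ 0 ↔ _
    rw [L_zero, cayley_re, norm_smul]
    have : ‖1 - (s : ℂ) * z‖ ^ 2 ≠ 0 := by
      simpa [sub_eq_zero] using Ne.symm hz
    rw [eq_comm, div_eq_zero_iff, or_iff_left this, sub_eq_zero, eq_comm, pow_eq_one_iff_of_nonneg (norm_nonneg _) two_ne_zero]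
  ext z
  change _ ∈ frontier _ ↔ _
  have hz := mem_chart_source (EuclideanHalfSpace 2) z
  obtain ⟨s, hs⟩ := chart_mem_atlas (EuclideanHalfSpace 2) z
  simp only [extChartAt, OpenPartialHomeomorph.extend, PartialEquiv.coe_trans, Function.comp_apply]
  rw [← hs] at hz ⊢
  exact key s z hz

end Disk

namespace Disk

open SingularRel

/-- The boundary labels of the disk: a point `z` of the unit circle is in `S₊`, `Λ`, `S₋` according
as the real part of `(-z)^(p+1)` is positive, zero, negative. So `S₊` consists of `p + 1` equally
spaced intervals, one of them around `-1`. -/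
def height (p : ℕ) (z : D) : ℝ := ((-(z : ℂ)) ^ (p + 1)).re

theorem continuous_height (p : ℕ) : Continuous (height p) := by
  unfold height; fun_prop

/-- The unit circle. -/
def circ : Set D := {z | ‖(z : ℂ)‖ = 1}
/-- The sutures `Λ`. -/
def sutures (p : ℕ) : Set D := {z | ‖(z : ℂ)‖ = 1 ∧ height p z = 0}
/-- `S₊`. -/
def plus (p : ℕ) : Set D := {z | ‖(z : ℂ)‖ = 1 ∧ 0 < height p z}
/-- `S₋`. -/
def minus (p : ℕ) : Set D := {z | ‖(z : ℂ)‖ = 1 ∧ height p z < 0}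

theorem norm_pow_eq (p : ℕ) {z : D} (hz : ‖(z : ℂ)‖ = 1) : ‖(-(z : ℂ)) ^ (p + 1)‖ = 1 := by
  rw [norm_pow, norm_neg, hz, one_pow]

theorem pow_of_mem_sutures (p : ℕ) {z : D} (hz : z ∈ sutures p) :
    ∃ c : ℝ, (c = 1 ∨ c = -1) ∧ (-(z : ℂ)) ^ (p + 1) = c * Complex.I := by
  have h1 := norm_pow_eq p hz.1
  have h2 : ((-(z : ℂ)) ^ (p + 1)).re = 0 := hz.2
  set w := (-(z : ℂ)) ^ (p + 1)
  refine ⟨w.im, ?_, ?_⟩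
  · have := Complex.sq_norm_sub_sq_re w
    rw [h1, h2] at this
    have h3 : w.im ^ 2 = 1 := by linarith
    rcases mul_eq_zero.1 (show (w.im - 1) * (w.im + 1) = 0 by linarith) with h | h
    · exact Or.inl (by linarith)
    · exact Or.inr (by linarith)
  · apply Complex.ext <;> simp [h2]

theorem sutures_finite (p : ℕ) : (sutures p).Finite := by
  have hne : (Polynomial.X ^ (2 * (p + 1)) - Polynomial.C (-1 : ℂ)) ≠ 0 :=
    Polynomial.X_pow_sub_C_ne_zero (by omega) _
  have hfin := (Polynomial.X ^ (2 * (p + 1)) - Polynomial.C (-1 : ℂ)).rootSet_finite ℂ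
  refine Set.Finite.of_finite_image (f := fun z : D => -(z : ℂ)) (hfin.subset ?_)
    (fun a _ b _ h => Subtype.ext (neg_injective h))
  rintro _ ⟨z, hz, rfl⟩
  rw [Polynomial.mem_rootSet]
  refine ⟨hne, ?_⟩
  obtain ⟨c, hc, h⟩ := pow_of_mem_sutures p hz
  simp only [map_sub, map_pow, Polynomial.aeval_X, Polynomial.aeval_C]
  rw [mul_comm 2, pow_mul, h, mul_pow, Complex.I_sq]
  rcases hc with rfl | rfl <;> simp

/-- The point `exp (i t)`. -/
def circPt (t : ℝ) : D := ⟨Complex.exp (t * Complex.I), by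
  rw [mem_closedBall_zero_iff, Complex.norm_exp_ofReal_mul_I]⟩

theorem continuous_circPt : Continuous circPt := by
  unfold circPt; fun_prop

theorem circ_isPreconnected : IsPreconnected circ := by
  have : circ = Set.range circPt := by
    ext z
    constructor
    · intro hz
      obtain ⟨t, ht⟩ := (Complex.norm_eq_one_iff _).1 hz
      exact ⟨t, Subtype.ext ht⟩
    · rintro ⟨t, rfl⟩
      exact Complex.norm_exp_ofReal_mul_I t
  rw [this]
  exact isPreconnected_range continuous_circPt

/-- Complex conjugation. -/
def conj (z : D) : D := ⟨(starRingEnd ℂ) z, by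
  rw [mem_closedBall_zero_iff, Complex.norm_conj]; exact D_norm_le z⟩

theorem sutures_even (p : ℕ) : Even (sutures p).ncard := by
  classical
  have hfin := sutures_finite p
  rw [Set.ncard_eq_toFinset_card _ hfin]
  have : ∑ _z ∈ hfin.toFinset, (1 : ZMod 2) = 0 := by
    refine Finset.sum_involution (fun z _ => conj z) (fun _ _ => by decide) ?_ ?_ ?_
    · intro z hz _ h
      obtain ⟨c, hc, h2⟩ := pow_of_mem_sutures p (hfin.mem_toFinset.1 hz)
      have h3 : (starRingEnd ℂ) (z : ℂ) = z := congrArg Subtype.val h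
      have h4 : (starRingEnd ℂ) ((-(z : ℂ)) ^ (p + 1)) = (-(z : ℂ)) ^ (p + 1) := by
        rw [map_pow, map_neg, h3]
      rw [h2] at h4
      have := congrArg Complex.im h4
      simp at this
      rcases hc with rfl | rfl <;> norm_num at this
    · intro z hz
      rw [hfin.mem_toFinset] at hz ⊢
      refine ⟨(Complex.norm_conj _).trans hz.1, ?_⟩
      have h2 : ((-(z : ℂ)) ^ (p + 1)).re = 0 := hz.2
      change ((-((starRingEnd ℂ) (z : ℂ))) ^ (p + 1)).re = 0
      rw [← map_neg, ← map_pow, Complex.conj_re, h2]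
    · intro z _
      exact Subtype.ext (Complex.conj_conj _)
  rw [Finset.sum_const, nsmul_eq_mul, mul_one] at this
  exact (ZMod.natCast_eq_zero_iff_even).1 this

theorem plus_union_minus (p : ℕ) : plus p ∪ minus p = circ \ sutures p := by
  ext z
  simp only [plus, minus, circ, sutures, Set.mem_union, Set.mem_ofPred_eq, Set.mem_sdiff, not_and]
  constructor
  · rintro (⟨h, h'⟩ | ⟨h, h'⟩)
    · exact ⟨h, fun _ => h'.ne'⟩
    · exact ⟨h, fun _ => h'.ne⟩
  · rintro ⟨h, h'⟩
    rcases lt_or_gt_of_ne (h' h) with h2 | h2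
    · exact Or.inr ⟨h, h2⟩
    · exact Or.inl ⟨h, h2⟩

theorem component_subset (p : ℕ) (x : D) (u v : Set D) (hu : IsOpen u) (hv : IsOpen v)
    (huv : Disjoint u v) (h : circ \ sutures p ⊆ u ∪ v) (hx : x ∈ u) (hx' : x ∈ circ \ sutures p) :
    connectedComponentIn (circ \ sutures p) x ⊆ u :=
  isPreconnected_connectedComponentIn.subset_left_of_subset_union hu hv huv
    ((connectedComponentIn_subset _ _).trans h) ⟨x, mem_connectedComponentIn hx', hx⟩

theorem plus_component (p : ℕ) (x : D) (hx : x ∈ plus p) :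
    connectedComponentIn (circ \ sutures p) x ⊆ plus p := by
  have hsub : circ \ sutures p ⊆ {z | 0 < height p z} ∪ {z | height p z < 0} := by
    rw [← plus_union_minus]
    exact Set.union_subset_union (fun _ h => h.2) (fun _ h => h.2)
  have := component_subset p x {z | 0 < height p z} {z | height p z < 0}
    (isOpen_lt continuous_const (continuous_height p))
    (isOpen_lt (continuous_height p) continuous_const)
    (Set.disjoint_left.2 fun z (h : 0 < height p z) (h' : height p z < 0) => lt_asymm h h') hsub hx.2
    (plus_union_minus p ▸ Or.inl hx)
  exact fun z hz => ⟨(connectedComponentIn_subset _ _ hz).1, this hz⟩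

theorem minus_component (p : ℕ) (x : D) (hx : x ∈ minus p) :
    connectedComponentIn (circ \ sutures p) x ⊆ minus p := by
  have hsub : circ \ sutures p ⊆ {z | height p z < 0} ∪ {z | 0 < height p z} := by
    rw [← plus_union_minus, Set.union_comm]
    exact Set.union_subset_union (fun _ h => h.2) (fun _ h => h.2)
  have := component_subset p x {z | height p z < 0} {z | 0 < height p z}
    (isOpen_lt (continuous_height p) continuous_const)
    (isOpen_lt continuous_const (continuous_height p))
    (Set.disjoint_left.2 fun z (h : height p z < 0) (h' : 0 < height p z) => lt_asymm h h') hsub hx.2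
    (plus_union_minus p ▸ Or.inr hx)
  exact fun z hz => ⟨(connectedComponentIn_subset _ _ hz).1, this hz⟩

/-- Rotation of the point `z` of the disk by the angle `t`. -/
def rot (z : D) (t : ℝ) : D := ⟨z * Complex.exp (t * Complex.I), by
  rw [mem_closedBall_zero_iff, norm_mul, Complex.norm_exp_ofReal_mul_I, mul_one]
  exact D_norm_le z⟩

theorem norm_rot (z : D) (t : ℝ) : ‖(rot z t : ℂ)‖ = ‖(z : ℂ)‖ := by
  change ‖(z : ℂ) * _‖ = _
  rw [norm_mul, Complex.norm_exp_ofReal_mul_I, mul_one]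

theorem height_rot (p : ℕ) (z : D) (t : ℝ) : height p (rot z t) =
    ((-(z : ℂ)) ^ (p + 1) * Complex.exp (((p + 1) * t : ℝ) * Complex.I)).re := by
  unfold height rot
  dsimp only
  rw [← neg_mul, mul_pow, ← Complex.exp_nat_mul]
  push_cast
  ring_nf

theorem mem_closure_of_rot (p : ℕ) (z : D) (T : Set D) (b : ℝ)
    (h : ∀ τ ∈ Set.Ioo (0 : ℝ) Real.pi, rot z (b * τ / (p + 1)) ∈ T) : z ∈ closure T := by
  have hc : Continuous fun τ : ℝ => rot z (b * τ / (p + 1)) := by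
    unfold rot; fun_prop
  have h0 : rot z (b * 0 / (p + 1)) = z := Subtype.ext (by simp [rot])
  have ht : Filter.Tendsto (fun τ : ℝ => rot z (b * τ / (p + 1))) (𝓝[>] 0) (𝓝 z) := by
    have := hc.tendsto 0
    rw [h0] at this
    exact this.mono_left nhdsWithin_le_nhds
  refine mem_closure_of_tendsto ht ?_
  filter_upwards [Ioo_mem_nhdsGT Real.pi_pos] with τ hτ using h τ hτ

theorem sutures_alternating (p : ℕ) (z : D) (hz : z ∈ sutures p) :
    z ∈ closure (plus p) ∧ z ∈ closure (minus p) := by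
  obtain ⟨c, hc, h⟩ := pow_of_mem_sutures p hz
  have key (b τ : ℝ) : height p (rot z (b * τ / (p + 1))) = -c * Real.sin (b * τ) := by
    rw [height_rot, h]
    have : ((p : ℝ) + 1) * (b * τ / (p + 1)) = b * τ := by field_simp
    rw [this, Complex.mul_re, Complex.exp_ofReal_mul_I_re, Complex.exp_ofReal_mul_I_im]
    simp
  constructor
  · refine mem_closure_of_rot p z _ (-c) fun τ hτ => ⟨(norm_rot z _).trans hz.1, ?_⟩
    have := Real.sin_pos_of_mem_Ioo hτ
    rw [key]
    rcases hc with rfl | rfl <;> simpa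
  · refine mem_closure_of_rot p z _ c fun τ hτ => ⟨(norm_rot z _).trans hz.1, ?_⟩
    have := Real.sin_pos_of_mem_Ioo hτ
    rw [key]
    rcases hc with rfl | rfl <;> simpa

/-- The midpoint `-exp(-2πik/(p+1))` of the `k`-th interval of `S₊`, counted clockwise from `-1`. -/
def center (p : ℕ) (k : Fin (p + 1)) : D :=
  rot ⟨-1, by simp⟩ (-(2 * Real.pi * k / (p + 1)))

theorem neg_center (p : ℕ) (k : Fin (p + 1)) : -(center p k : ℂ) =
    Complex.exp (-(2 * Real.pi * Complex.I * (k / (p + 1 : ℕ)))) := by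
  change -(-1 * Complex.exp _) = _
  rw [neg_one_mul, neg_neg]
  congr 1
  push_cast
  ring

theorem neg_center_pow (p : ℕ) (k : Fin (p + 1)) : (-(center p k : ℂ)) ^ (p + 1) = 1 := by
  rw [neg_center, ← Complex.exp_nat_mul, Complex.exp_eq_one_iff]
  refine ⟨-(k : ℤ), ?_⟩
  have : ((p : ℂ) + 1) ≠ 0 := by exact_mod_cast Nat.succ_ne_zero p
  push_cast
  field_simp

theorem center_mem (p : ℕ) (k : Fin (p + 1)) : center p k ∈ plus p := by
  refine ⟨(norm_rot _ _).trans (by simp), ?_⟩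
  unfold height
  rw [neg_center_pow]
  simp

/-- The `(p+1)`-st root of unity that labels the interval containing `z`. -/
def root (p : ℕ) (z : D) : ℂ :=
  -(z : ℂ) * Complex.exp (-(Complex.log ((-(z : ℂ)) ^ (p + 1)) / (p + 1)))

theorem root_pow (p : ℕ) {z : D} (hz : z ∈ plus p) : root p z ^ (p + 1) = 1 := by
  have hne : (-(z : ℂ)) ^ (p + 1) ≠ 0 := by
    rw [← norm_ne_zero_iff, norm_pow_eq p hz.1]; exact one_ne_zero
  have : ((p : ℂ) + 1) ≠ 0 := by exact_mod_cast Nat.succ_ne_zero p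
  unfold root
  rw [mul_pow, ← Complex.exp_nat_mul]
  push_cast
  rw [mul_neg, mul_div_cancel₀ _ this, Complex.exp_neg, Complex.exp_log hne, mul_inv_cancel₀ hne]

theorem root_center (p : ℕ) (k : Fin (p + 1)) : root p (center p k) = -(center p k : ℂ) := by
  unfold root
  rw [neg_center_pow]
  simp

theorem continuous_root (p : ℕ) : Continuous fun z : plus p => root p z := by
  unfold root
  refine Continuous.mul (by fun_prop) (Complex.continuous_exp.comp
    (((Continuous.clog (by fun_prop) ?_).div_const _).neg))
  rintro ⟨z, hz⟩
  exact Or.inl hz.2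

/-- The midpoint of the `k`-th interval, as a point of `S₊`. -/
def centerPt (p : ℕ) (k : Fin (p + 1)) : plus p := ⟨center p k, center_mem p k⟩

theorem root_eq_of_component (p : ℕ) (x y : plus p)
    (h : (ConnectedComponents.mk x : ConnectedComponents (plus p)) = ConnectedComponents.mk y) :
    root p x = root p y := by
  have hx : x ∈ connectedComponent y := ConnectedComponents.coe_eq_coe'.1 h
  have hpre : IsPreconnected ((fun z : plus p => root p z) '' connectedComponent y) :=
    isPreconnected_connectedComponent.image _ (continuous_root p).continuousOn
  have hfin : {w : ℂ | w ^ (p + 1) = 1}.Finite := by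
    have := (Polynomial.X ^ (p + 1) - Polynomial.C (1 : ℂ)).rootSet_finite ℂ
    refine this.subset fun w (hw : w ^ (p + 1) = 1) => ?_
    rw [Polynomial.mem_rootSet]
    exact ⟨Polynomial.X_pow_sub_C_ne_zero (by omega) _, by simp [hw]⟩
  have hsub : ((fun z : plus p => root p z) '' connectedComponent y).Finite := by
    refine hfin.subset ?_
    rintro _ ⟨z, _, rfl⟩
    exact root_pow p z.2
  exact hsub.countable.isTotallyDisconnected _ subset_rfl hpre ⟨x, hx, rfl⟩
    ⟨y, mem_connectedComponent, rfl⟩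

theorem centerPt_injective (p : ℕ) : Function.Injective fun k =>
    (ConnectedComponents.mk (centerPt p k) : ConnectedComponents (plus p)) := by
  intro k l h
  have h1 := root_eq_of_component p _ _ h
  change root p (center p k) = root p (center p l) at h1
  rw [root_center, root_center, neg_center, neg_center, Complex.exp_neg, Complex.exp_neg,
    inv_inj] at h1
  have hprim := Complex.isPrimitiveRoot_exp (p + 1) (by omega)
  have h2 (j : Fin (p + 1)) : Complex.exp (2 * Real.pi * Complex.I * (j / (p + 1 : ℕ))) =
      Complex.exp (2 * Real.pi * Complex.I / (p + 1 : ℕ)) ^ (j : ℕ) := by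
    rw [← Complex.exp_nat_mul]
    congr 1
    ring
  rw [h2, h2] at h1
  exact Fin.ext (hprim.pow_inj k.2 l.2 h1)

theorem centerPt_surjective (p : ℕ) : Function.Surjective fun k =>
    (ConnectedComponents.mk (centerPt p k) : ConnectedComponents (plus p)) := by
  intro I
  obtain ⟨⟨z, hz⟩, rfl⟩ := ConnectedComponents.surjective_coe I
  have hprim := Complex.isPrimitiveRoot_exp (p + 1) (by omega)
  have hr := root_pow p hz
  obtain ⟨k, hk, hk'⟩ := hprim.eq_pow_of_pow_eq_one (ξ := (root p z)⁻¹)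
    (by rw [inv_pow, hr, inv_one])
  refine ⟨⟨k, hk⟩, ?_⟩
  have hroot : root p z = -(center p ⟨k, hk⟩ : ℂ) := by
    rw [neg_center, Complex.exp_neg, ← inv_inj, inv_inv, ← hk', ← Complex.exp_nat_mul]
    congr 1
    simp
    ring
  set θ := Complex.arg ((-(z : ℂ)) ^ (p + 1)) with hθ
  have hnorm := norm_pow_eq p hz.1
  have hlog : Complex.log ((-(z : ℂ)) ^ (p + 1)) = θ * Complex.I := by
    rw [Complex.log, hnorm]; simp [hθ]
  have habs : |θ| < Real.pi / 2 := Complex.abs_arg_lt_pi_div_two_iff.2 (Or.inl hz.2)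
  have hzrot : rot (center p ⟨k, hk⟩) (θ / (p + 1)) = z := by
    apply Subtype.ext
    change (center p ⟨k, hk⟩ : ℂ) * _ = z
    rw [← neg_inj, ← neg_mul, ← hroot, root, hlog, mul_assoc, ← Complex.exp_add]
    have : -((θ : ℂ) * Complex.I / (p + 1)) + ((θ / (p + 1) : ℝ) : ℂ) * Complex.I = 0 := by
      push_cast; ring
    rw [this, Complex.exp_zero, mul_one]
  have hmem (t : Set.Icc (0 : ℝ) 1) : rot (center p ⟨k, hk⟩) (t * θ / (p + 1)) ∈ plus p := by
    refine ⟨(norm_rot _ _).trans (center_mem p _).1, ?_⟩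
    rw [height_rot, neg_center_pow, one_mul]
    have h1 : ((p : ℝ) + 1) * (t * θ / (p + 1)) = t * θ := by field_simp
    rw [h1, Complex.exp_ofReal_mul_I_re]
    apply Real.cos_pos_of_mem_Ioo
    have h2 : |(t : ℝ) * θ| ≤ |θ| := by
      rw [abs_mul, abs_of_nonneg t.2.1]
      exact mul_le_of_le_one_left (abs_nonneg _) t.2.2
    exact abs_lt.1 (h2.trans_lt habs)
  have hcont : Continuous fun t : Set.Icc (0 : ℝ) 1 =>
      (⟨rot (center p ⟨k, hk⟩) (t * θ / (p + 1)), hmem t⟩ : plus p) := by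
    unfold rot; fun_prop
  have hpre := isPreconnected_range hcont
  refine ConnectedComponents.coe_eq_coe'.2 (hpre.subset_connectedComponent ⟨1, ?_⟩ ⟨0, ?_⟩)
  · apply Subtype.ext
    simp [hzrot]
  · apply Subtype.ext
    apply Subtype.ext
    simp [rot, centerPt]

end Disk

/-- The open `p`-tuple of pants: a disk with `p + 1` intervals of `S₊` on its boundary. The outgoing
interval is on the left, around `-1`; the `p` incoming intervals follow in clockwise order, that is,
from top to bottom when they are moved to the right side. -/
def openPants (p : ℕ) : SuturedSurface.{0} p 1 where
  carrier := Disk.D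
  oriented := by
    rintro _ ⟨s, rfl⟩ _ ⟨s', rfl⟩ x hx
    exact Disk.chart_oriented s s' x hx
  Λ := Disk.sutures p
  Splus := Disk.plus p
  Sminus := Disk.minus p
  Λ_subset := by
    rw [Disk.boundary_eq]; exact fun z hz => hz.1
  Λ_finite := Disk.sutures_finite p
  Λ_even := by
    intro x hx
    rw [Disk.boundary_eq] at hx ⊢
    change Even (Disk.sutures p ∩ connectedComponentIn Disk.circ x).ncard
    rw [Disk.circ_isPreconnected.connectedComponentIn hx,
      Set.inter_eq_left.2 (fun z hz => hz.1)]
    exact Disk.sutures_even p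
  disjoint := Set.disjoint_left.2 fun z h h' => lt_asymm h.2 h'.2
  union := by rw [Disk.boundary_eq]; exact Disk.plus_union_minus p
  plus_component := by rw [Disk.boundary_eq]; exact Disk.plus_component p
  minus_component := by rw [Disk.boundary_eq]; exact Disk.minus_component p
  alternating := Disk.sutures_alternating p
  inc i := ConnectedComponents.mk (Disk.centerPt p i.succ)
  out _ := ConnectedComponents.mk (Disk.centerPt p 0)
  label_bijective := by
    have hi := Disk.centerPt_injective p
    refine ⟨?_, fun I => ?_⟩
    · rintro (i | i) (j | j) h
      · exact congrArg Sum.inl (Fin.succ_injective _ (hi h))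
      · exact absurd (hi h) (Fin.succ_ne_zero i)
      · exact absurd (hi h).symm (Fin.succ_ne_zero j)
      · exact congrArg Sum.inr (Subsingleton.elim i j)
    · obtain ⟨k, hk⟩ := Disk.centerPt_surjective p I
      refine Fin.cases (fun hk => ⟨Sum.inr 0, hk⟩) (fun j hk => ⟨Sum.inl j, hk⟩) k hk

/-- `P` is an open `p`-tuple of pants. -/
def SuturedSurface.IsOpenPants {p : ℕ} (P : SuturedSurface.{u} p 1) : Prop :=
  Nonempty (SuturedSurface.Iso P (openPants p))

/-- For each `i`, an arc joining the outgoing interval to the `i`-th incoming interval. -/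
structure PantsArcs {p : ℕ} (P : SuturedSurface.{u} p 1) where
  left : Fin p → P.carrier
  right : Fin p → P.carrier
  left_mem : ∀ i, left i ∈ SingularRel.componentSet (P.out 0)
  right_mem : ∀ i, right i ∈ SingularRel.componentSet (P.inc i)
  arc : ∀ i, Path (left i) (right i)

namespace PantsArcs

variable (R : Type) [CommRing R] {p : ℕ} {P : SuturedSurface.{u} p 1} (γ : PantsArcs P)

/-- The classes `e_1, …, e_p` (written `e 0, …, e (p-1)`) of the arcs, with alternating orientations:
`e_p` points from the outgoing to the incoming boundary, `e_{p-1}` from the incoming to the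
outgoing boundary, and so forth. -/
def e (i : Fin p) : P.H R :=
  if Even (p - ((i : ℕ) + 1)) then
    SingularRel.arcClass R (γ.arc i) (γ.left_mem i).1 (γ.right_mem i).1
  else
    SingularRel.arcClass R (γ.arc i).symm (γ.right_mem i).1 (γ.left_mem i).1

/-- The classes `e_i` form a basis of `H_1(P, S₊; R)`. -/
def IsBasis : Prop := LinearIndependent R (γ.e R) ∧ Submodule.span R (Set.range (γ.e R)) = ⊤

/-- The wedge product of the `e_i`, `i ∈ s`, in increasing order of `i`. -/
def wedge (s : Finset (Fin p)) : ExteriorAlgebra R (P.H R) :=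
  ((s.sort (· ≤ ·)).map fun i => ExteriorAlgebra.ι R (γ.e R i)).prod

end PantsArcs

end

/-! A class in `H_1(P, S₊)` of the contractible surface `P` is determined by its boundary in
`H_0(S₊)`, whose coefficients sum to zero. Since `φ_{I_j}(e_i) = ± δ_{ij}` for the incoming
intervals `I_j`, the `e_i` form a basis, and `φ_I = -∑ j, φ_{I_j}` for the outgoing interval `I`.

With the orientations alternating as they do, the right action of a product of the `E_j`, taken in
increasing order, on `ε ⊗ (e_1 ∧ ⋯ ∧ e_p)` removes the corresponding factors without any sign.
Hence `x ↦ (ε ⊗ (e_1 ∧ ⋯ ∧ e_p)) · x` is an isomorphism of right modules from `(R[E]/(E²))^{⊗p}`,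
which sends the product of the `E_j`, `j ∉ s`, to `ε ⊗ e_s`. As the left and right actions
commute, left linearity need only be checked on the top generator, where the outgoing contraction
is the sum of the incoming ones, that is, right multiplication by `Δ(E) = ∑ j, E_j`. -/

noncomputable section

section SortedLists

variable {α : Type*} [LinearOrder α]

theorem sort_eq_sort_lt_append_cons {s : Finset α} {j : α} (hj : j ∈ s) :
    s.sort (· ≤ ·) = {i ∈ s | i < j}.sort (· ≤ ·) ++ j :: {i ∈ s | j < i}.sort (· ≤ ·) := by
  refine (Finset.sortedLT_sort s).eq_of_mem_iff (List.Pairwise.sortedLT ?_) fun i => ?_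
  · refine List.pairwise_append.2 ⟨(Finset.sortedLT_sort _).pairwise,
      List.pairwise_cons.2 ⟨by simp, (Finset.sortedLT_sort _).pairwise⟩, ?_⟩
    simp only [Finset.mem_sort, Finset.mem_filter, List.mem_cons]
    rintro a ⟨_, ha⟩ b (rfl | ⟨_, hb⟩)
    exacts [ha, ha.trans hb]
  · simp only [Finset.mem_sort, Finset.mem_filter, List.mem_cons, List.mem_append]
    rcases lt_trichotomy i j with h | rfl | h
    · simp [h, h.ne, h.not_gt]
    · simp [hj]
    · simp [h, h.ne', h.not_gt]

theorem sort_erase_eq_sort_lt_append {s : Finset α} {j : α} (hj : j ∈ s) :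
    (s.erase j).sort (· ≤ ·) = {i ∈ s | i < j}.sort (· ≤ ·) ++ {i ∈ s | j < i}.sort (· ≤ ·) := by
  have h := congrArg (List.erase · j) (sort_eq_sort_lt_append_cons hj)
  rw [List.erase_append_right _ (by simp), List.erase_cons_head] at h
  rw [← h]
  exact (Finset.sortedLT_sort _).eq_of_mem_iff
    (((Finset.sortedLT_sort s).pairwise.erase j).sortedLT) fun i => by
      rw [(Finset.sort_nodup s _).mem_erase_iff]; simp

end SortedLists

theorem sort_map_succEmb {p : ℕ} (s : Finset (Fin p)) :
    (s.map (Fin.succEmb p)).sort (· ≤ ·) = (s.sort (· ≤ ·)).map Fin.succ :=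
  (Finset.map_sort (r := (· ≤ ·)) (r' := (· ≤ ·)) (Fin.succEmb p) s
    (fun _ _ _ _ => Fin.succ_le_succ_iff.symm)).symm

theorem sort_insert_zero_map_succEmb {p : ℕ} (s : Finset (Fin p)) :
    (insert 0 (s.map (Fin.succEmb p))).sort (· ≤ ·) = 0 :: (s.sort (· ≤ ·)).map Fin.succ := by
  rw [Finset.sort_insert (· ≤ ·) (fun b _ => Fin.zero_le b) (by simp [Fin.succ_ne_zero]),
    sort_map_succEmb]

section Spans

variable {R ι κ M : Type*} [Semiring R] [AddCommMonoid M] [Module R M]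

theorem iSup_span_image_fiber (x : κ → M) (f : κ → ι) (P : ι → Prop) :
    ⨆ (n : ι) (_ : P n), Submodule.span R (x '' (f ⁻¹' {n})) =
      Submodule.span R (x '' {s | P (f s)}) := by
  simp_rw [← Submodule.span_iUnion, ← Set.image_iUnion]
  congr 2
  ext s
  simp

theorem eq_span_of_homogeneous [DecidableEq ι] (ℳ : ι → Submodule R M)
    [DirectSum.Decomposition ℳ] {x : κ → M} {f : κ → ι} (hx : ∀ s, x s ∈ ℳ (f s))
    (hspan : Submodule.span R (Set.range x) = ⊤) (n : ι) :
    ℳ n = Submodule.span R (x '' (f ⁻¹' {n})) := by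
  let π : M →ₗ[R] M :=
    (ℳ n).subtype ∘ₗ DirectSum.component R ι _ n ∘ₗ (DirectSum.decomposeLinearEquiv ℳ).toLinearMap
  have hπ (y : M) : π y = DirectSum.decompose ℳ y n := rfl
  apply le_antisymm
  · intro y hy
    have hmem : π y ∈ (Submodule.span R (Set.range x)).map π :=
      Submodule.mem_map_of_mem (hspan ▸ Submodule.mem_top)
    rw [hπ, DirectSum.decompose_of_mem_same _ hy, Submodule.map_span] at hmem
    refine Submodule.span_le.2 ?_ hmem
    rintro _ ⟨_, ⟨s, rfl⟩, rfl⟩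
    rw [hπ]
    by_cases hs : f s = n
    · subst hs
      rw [DirectSum.decompose_of_mem_same _ (hx s)]
      exact Submodule.subset_span ⟨s, rfl, rfl⟩
    · rw [DirectSum.decompose_of_mem_ne _ (hx s) hs]
      exact zero_mem _
  · rw [Submodule.span_le]
    rintro _ ⟨s, rfl, rfl⟩
    exact hx s

end Spans

namespace GrAlg

variable {R : Type} [CommRing R]

theorem superGr_eq_span {ι : Type*} (B : GrAlg R) {x : ι → B.carrier} {f : ι → ℤ}
    (hx : ∀ s, x s ∈ B.gr (f s)) (hspan : Submodule.span R (Set.range x) = ⊤) (q : ℚ) (a : ZMod 2) :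
    B.superGr q a = Submodule.span R (x '' {s | (f s : ℚ) = q ∧ (f s : ZMod 2) = a}) := by
  simp_rw [superGr, eq_span_of_homogeneous B.gr hx hspan]
  exact iSup_span_image_fiber x f _

theorem eq_fst_smul_one_add_snd_smul_eps (a : DualNumber R) :
    a = a.fst • 1 + a.snd • DualNumber.eps := by
  ext <;> simp

theorem prodE_map_succEmb (p : ℕ) (s : Finset (Fin p)) :
    prodE R (p + 1) (s.map (Fin.succEmb p)) =
      ((1 : DualNumber R) ᵍ⊗ₜ[R] prodE R p s : dualGr R ᵍ⊗[R] (dualPow R p).gr) := by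
  change _ = GradedTensorProduct.includeRight (dualGr R) (dualPow R p).gr (prodE R p s)
  rw [prodE, sort_map_succEmb, List.map_map, prodE, map_list_prod, List.map_map]
  rfl

theorem prodE_insert_zero_map_succEmb (p : ℕ) (s : Finset (Fin p)) :
    prodE R (p + 1) (insert 0 (s.map (Fin.succEmb p))) =
      (DualNumber.eps ᵍ⊗ₜ[R] prodE R p s : dualGr R ᵍ⊗[R] (dualPow R p).gr) := by
  have hcons : prodE R (p + 1) (insert 0 (s.map (Fin.succEmb p))) =
      E R (p + 1) 0 * prodE R (p + 1) (s.map (Fin.succEmb p)) := by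
    rw [prodE, sort_insert_zero_map_succEmb, List.map_cons, List.prod_cons, ← sort_map_succEmb,
      ← prodE]
  rw [hcons, prodE_map_succEmb]
  exact GradedTensorProduct.tmul_one_mul_one_tmul (dualGr R) (dualPow R p).gr _ _

theorem tmul_mem_of_one_of_eps {B : Type} [Ring B] [Algebra R B] (ℬ : ℤ → Submodule R B)
    [GradedAlgebra ℬ] {T : Submodule R (dualGr R ᵍ⊗[R] ℬ)} {b : B}
    (h1 : ((1 : DualNumber R) ᵍ⊗ₜ[R] b : dualGr R ᵍ⊗[R] ℬ) ∈ T)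
    (heps : (DualNumber.eps ᵍ⊗ₜ[R] b : dualGr R ᵍ⊗[R] ℬ) ∈ T) (a : DualNumber R) :
    (a ᵍ⊗ₜ[R] b : dualGr R ᵍ⊗[R] ℬ) ∈ T := by
  rw [eq_fst_smul_one_add_snd_smul_eps a, GradedTensorProduct.tmul, TensorProduct.add_tmul,
    ← TensorProduct.smul_tmul', ← TensorProduct.smul_tmul', map_add, map_smul, map_smul]
  exact add_mem (T.smul_mem _ h1) (T.smul_mem _ heps)

theorem span_range_prodE (p : ℕ) : Submodule.span R (Set.range (prodE R p)) = ⊤ := by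
  induction p with
  | zero =>
    refine eq_top_iff.2 fun (x : R) _ => ?_
    have hx : x • prodE R 0 ∅ = x := by
      rw [prodE, Finset.sort_empty]
      exact mul_one x
    exact hx ▸ Submodule.smul_mem _ x (Submodule.subset_span ⟨∅, rfl⟩)
  | succ p ih =>
    let T : Submodule R (dualGr R ᵍ⊗[R] (dualPow R p).gr) :=
      Submodule.span R (Set.range (prodE R (p + 1)))
    have htmul (a : DualNumber R) (b : (dualPow R p).carrier) :
        (a ᵍ⊗ₜ[R] b : dualGr R ᵍ⊗[R] (dualPow R p).gr) ∈ T := by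
      have hb : b ∈ Submodule.span R (Set.range (prodE R p)) := ih ▸ Submodule.mem_top
      let tmulLeft := (GradedTensorProduct.of R (dualGr R) (dualPow R p).gr).toLinearMap ∘ₗ
        TensorProduct.mk R _ _ a
      refine (Submodule.span_le (p := T.comap tmulLeft)).2 ?_ hb
      rintro _ ⟨s, rfl⟩
      have h1 : _ ∈ T := Submodule.subset_span ⟨_, prodE_map_succEmb p s⟩
      have heps : _ ∈ T := Submodule.subset_span ⟨_, prodE_insert_zero_map_succEmb p s⟩
      exact tmul_mem_of_one_of_eps _ h1 heps a
    refine eq_top_iff.2 fun (x : dualGr R ᵍ⊗[R] (dualPow R p).gr) _ => ?_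
    obtain ⟨x, rfl⟩ := (GradedTensorProduct.of R (dualGr R) (dualPow R p).gr).surjective x
    induction x using TensorProduct.induction_on with
    | zero => rw [map_zero]; exact zero_mem _
    | add x y hx hy => rw [map_add]; exact add_mem (hx trivial) (hy trivial)
    | tmul a b => exact htmul a b

theorem adjoin_range_E (p : ℕ) : Algebra.adjoin R (Set.range (E R p)) = ⊤ := by
  rw [← Algebra.toSubmodule_eq_top, eq_top_iff, ← span_range_prodE, Submodule.span_le]
  rintro _ ⟨s, rfl⟩
  change prodE R p s ∈ Algebra.adjoin R (Set.range (E R p))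
  refine list_prod_mem fun x hx => ?_
  obtain ⟨i, -, rfl⟩ := List.mem_map.1 hx
  exact Algebra.subset_adjoin ⟨i, rfl⟩

theorem E_mem (p : ℕ) (i : Fin p) : E R p i ∈ (dualPow R p).gr (-1) := by
  induction p with
  | zero => exact i.elim0
  | succ p ih =>
    refine Fin.cases ?_ (fun j => ?_) i
    · exact tmul_mem_tensorGr (dualGr R) (dualPow R p).gr (add_zero (-1)) eps_mem_dualGr
        SetLike.GradedOne.one_mem
    · exact tmul_mem_tensorGr (dualGr R) (dualPow R p).gr (zero_add (-1))
        SetLike.GradedOne.one_mem (ih j)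

theorem prodE_mem (p : ℕ) (s : Finset (Fin p)) : prodE R p s ∈ (dualPow R p).gr (-s.card) := by
  have hprod := SetLike.list_prod_map_mem_graded (A := (dualPow R p).gr) (s.sort (· ≤ ·))
    (fun _ => -1) (E R p) fun i _ => E_mem p i
  rwa [List.map_const', List.sum_replicate, Finset.length_sort, nsmul_eq_mul, mul_neg_one] at hprod

theorem superGr_dualPow (p : ℕ) (q : ℚ) (a : ZMod 2) :
    (dualPow R p).superGr q a =
      Submodule.span R (prodE R p '' {s | -(s.card : ℚ) = q ∧ (s.card : ZMod 2) = a}) := by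
  rw [superGr_eq_span _ (prodE_mem p) (span_range_prodE p)]
  simp

theorem iterCoproduct_succ (p : ℕ) (a : DualNumber R) : iterCoproduct (p + 1) a =
    GradedTensorProduct.of R (dualGr R) (dualPow R p).gr
      (TensorProduct.map LinearMap.id (iterCoproduct p)
        ((GradedTensorProduct.of R (dualGr R) (dualGr R)).symm (coproduct a))) := rfl

theorem iterCoproduct_one (p : ℕ) : iterCoproduct (R := R) p 1 = 1 := by
  induction p with
  | zero => rfl
  | succ p ih =>
    rw [iterCoproduct_succ, map_one]
    change (1 : DualNumber R) ᵍ⊗ₜ[R] iterCoproduct (R := R) p 1 = _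
    rw [ih]
    rfl

theorem iterCoproduct_eps (p : ℕ) : iterCoproduct (R := R) p DualNumber.eps = ∑ i, E R p i := by
  induction p with
  | zero => rfl
  | succ p ih =>
    have hΔ : iterCoproduct (R := R) (p + 1) DualNumber.eps =
        (DualNumber.eps ᵍ⊗ₜ[R] iterCoproduct (R := R) p 1 +
          (1 : DualNumber R) ᵍ⊗ₜ[R] iterCoproduct (R := R) p DualNumber.eps :
            dualGr R ᵍ⊗[R] (dualPow R p).gr) := by
      rw [iterCoproduct_succ, coproduct, dualLift_eps]
      rfl
    have hsum : ((1 : DualNumber R) ᵍ⊗ₜ[R] ∑ i, E R p i : dualGr R ᵍ⊗[R] (dualPow R p).gr) =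
        ∑ i : Fin p, E R (p + 1) i.succ :=
      map_sum (GradedTensorProduct.includeRight (dualGr R) (dualPow R p).gr) _ _
    rw [hΔ, ih, iterCoproduct_one, hsum, Fin.sum_univ_succ]
    rfl

end GrAlg

section Contractions

variable {R M : Type*} [CommRing R] [AddCommGroup M] [Module R M] {Q : QuadraticForm R M}

open CliffordAlgebra

theorem contractLeft_mul_ι (d : Module.Dual R M) (x : CliffordAlgebra Q) (m : M) :
    contractLeft d (x * ι Q m) = contractLeft d x * ι Q m + d m • involute x := by
  induction x using CliffordAlgebra.left_induction with
  | algebraMap r => simp [Algebra.algebraMap_eq_smul_one, smul_comm r]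
  | add x y hx hy =>
    rw [add_mul, map_add, map_add, map_add, hx, hy, add_mul, smul_add, add_add_add_comm]
  | ι_mul x v hx =>
    rw [mul_assoc, contractLeft_ι_mul, contractLeft_ι_mul, hx, map_mul, involute_ι]
    simp only [mul_add, sub_mul, smul_mul_assoc, mul_smul_comm, neg_mul, smul_neg, mul_assoc]
    abel

theorem contractRight_eq_neg_contractLeft_involute (d : Module.Dual R M) (x : CliffordAlgebra Q) :
    contractRight x d = -contractLeft d (involute x) := by
  induction x using CliffordAlgebra.right_induction with
  | algebraMap r => simp
  | add x y hx hy => simp only [map_add, LinearMap.add_apply, hx, hy, neg_add]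
  | mul_ι m x hx =>
    rw [contractRight_mul_ι, hx, map_mul, involute_ι, mul_neg, map_neg, contractLeft_mul_ι,
      involute_involute]
    simp only [neg_mul, neg_neg, sub_neg_eq_add]
    abel

theorem involute_contractLeft (d : Module.Dual R M) (x : CliffordAlgebra Q) :
    involute (contractLeft d x) = -contractLeft d (involute x) := by
  induction x using CliffordAlgebra.left_induction with
  | algebraMap r => simp
  | add x y hx hy => simp only [map_add, hx, hy, neg_add]
  | ι_mul x v hx =>
    rw [contractLeft_ι_mul, map_sub, map_smul, map_mul, map_mul, involute_ι, hx, neg_mul,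
      neg_mul, map_neg, contractLeft_ι_mul, mul_neg, neg_neg, neg_neg]

theorem contractRight_contractLeft (d d' : Module.Dual R M) (x : CliffordAlgebra Q) :
    contractRight (contractLeft d x) d' = contractLeft d (contractRight x d') := by
  rw [contractRight_eq_neg_contractLeft_involute, contractRight_eq_neg_contractLeft_involute,
    involute_contractLeft, map_neg, map_neg, neg_neg, contractLeft_comm]

theorem contractRight_mul_prod_map_ι {d : Module.Dual R M} {l : List M} (hl : ∀ v ∈ l, d v = 0)
    (x : CliffordAlgebra Q) :
    contractRight (x * (l.map (ι Q)).prod) d =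
      (-1 : R) ^ l.length • (contractRight x d * (l.map (ι Q)).prod) := by
  induction l generalizing x with
  | nil => simp
  | cons v l ih =>
    rw [List.forall_mem_cons] at hl
    rw [List.map_cons, List.prod_cons, ← mul_assoc, ih hl.2, contractRight_mul_ι, hl.1, zero_smul,
      zero_sub, List.length_cons, pow_succ, mul_neg_one, neg_smul, ← mul_assoc, neg_mul, smul_neg]

end Contractions

namespace ShiftedExt

open CliffordAlgebra (contractLeft contractRight involute)

variable {R : Type} [CommRing R]

section Wedge

variable {α M : Type*} [LinearOrder α] [AddCommGroup M] [Module R M]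

/-- The wedge product of the vectors `e i`, `i ∈ s`, in increasing order of `i`. -/
def wedge (e : α → M) (s : Finset α) : ExteriorAlgebra R M :=
  ((s.sort (· ≤ ·)).map fun i => ExteriorAlgebra.ι R (e i)).prod

theorem contractRight_wedge (e : α → M) {d : Module.Dual R M} {s : Finset α} {j : α} (hj : j ∈ s)
    (hd : ∀ i ∈ s, i ≠ j → d (e i) = 0) :
    contractRight (Q := 0) (wedge e s) d =
      ((-1) ^ {i ∈ s | j < i}.card * d (e j)) • wedge (R := R) e (s.erase j) := by
  have hmap (l : List α) : (l.map fun i => ExteriorAlgebra.ι R (e i)) =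
      (l.map e).map (CliffordAlgebra.ι 0) := by
    rw [List.map_map]
    rfl
  have hlt : contractRight (Q := 0)
      ((({i ∈ s | i < j}.sort (· ≤ ·)).map e).map (CliffordAlgebra.ι 0)).prod d = 0 := by
    rw [← one_mul (List.prod _), contractRight_mul_prod_map_ι, CliffordAlgebra.contractRight_one,
      zero_mul, smul_zero]
    simp only [List.mem_map, Finset.mem_sort, Finset.mem_filter]
    rintro _ ⟨i, ⟨his, hij⟩, rfl⟩
    exact hd i his hij.ne
  have hgt : ∀ v ∈ ({i ∈ s | j < i}.sort (· ≤ ·)).map e, d v = 0 := by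
    simp only [List.mem_map, Finset.mem_sort, Finset.mem_filter]
    rintro _ ⟨i, ⟨his, hij⟩, rfl⟩
    exact hd i his hij.ne'
  rw [wedge, wedge, hmap, hmap, sort_eq_sort_lt_append_cons hj, sort_erase_eq_sort_lt_append hj,
    List.map_append, List.map_append, List.map_append, List.map_append, List.prod_append,
    List.prod_append, List.map_cons, List.map_cons, List.prod_cons, ← mul_assoc]
  refine (contractRight_mul_prod_map_ι hgt _).trans ?_
  rw [CliffordAlgebra.contractRight_mul_ι, hlt, zero_mul, sub_zero, smul_mul_assoc, smul_smul,
    List.length_map, Finset.length_sort]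

theorem involute_wedge (e : α → M) (s : Finset α) :
    involute (Q := 0) (wedge e s) = (-1 : R) ^ s.card • wedge (R := R) e s := by
  have h := CliffordAlgebra.involute_prod_map_ι (Q := (0 : QuadraticForm R M))
    ((s.sort (· ≤ ·)).map e)
  rwa [List.length_map, Finset.length_sort, List.map_map] at h

theorem basis_exteriorAlgebra_apply (b : Module.Basis α R M) (s : Finset α) :
    b.ExteriorAlgebra s = wedge b s := by
  rw [ExteriorAlgebra.basis_apply_ofCard b rfl, ExteriorAlgebra.ιMulti_family,
    ExteriorAlgebra.ιMulti_apply, wedge, Set.powersetCard.ofFinEmbEquiv_symm_apply,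
    ← Finset.listMap_orderEmbOfFin_finRange s rfl, List.map_map, List.ofFn_eq_map]
  rfl

theorem exteriorPower_eq_span (b : Module.Basis α R M) (j : ℕ) :
    ⋀[R]^j M = Submodule.span R (wedge b '' {s | s.card = j}) := by
  have h := congrArg (Submodule.map (⋀[R]^j M).subtype) (b.exteriorPower j).span_eq
  rw [Submodule.map_span, Submodule.map_top, Submodule.range_subtype, ← Set.range_comp] at h
  have hw (s : Set.powersetCard α j) : ((b.exteriorPower j s : ⋀[R]^j M) : ExteriorAlgebra R M) =
      wedge b (s : Finset α) := by
    rw [← basis_exteriorAlgebra_apply]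
    exact (ExteriorAlgebra.basis_eq_coe_basis b s).symm
  rw [← h, Set.image_eq_range]
  exact congrArg (Submodule.span R ∘ Set.range) (funext hw)

end Wedge

section Pure

/-- The isomorphism `n ↦ ε ⊗ n`. -/
def pureEquiv (R : Type) [CommRing R] (k : ℕ) (N : Type*) [AddCommGroup N] [Module R N] :
    N ≃ₗ[R] Prefactor R k ⊗[R] N :=
  (TensorProduct.lid R N).symm ≪≫ₗ TensorProduct.congr
    (PiTensorProduct.constantBaseRingEquiv (Fin k) R).symm.toLinearEquiv (LinearEquiv.refl R N)

theorem pureEquiv_apply (k : ℕ) {N : Type*} [AddCommGroup N] [Module R N] (n : N) :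
    pureEquiv R k N n = ε R k ⊗ₜ[R] n := by
  change ((PiTensorProduct.constantBaseRingEquiv (Fin k) R).symm 1 : Prefactor R k) ⊗ₜ[R] n = _
  rw [map_one]
  rfl

variable {M : Type u} [AddCommGroup M] [Module R M]

theorem wedgePart_eq_map_pureEquiv (k j : ℕ) :
    wedgePart R k M j = (⋀[R]^j M).map (pureEquiv R k (ExteriorAlgebra R M)).toLinearMap := by
  have hnat : (⋀[R]^j M).subtype.lTensor (Prefactor R k) ∘ₗ (pureEquiv R k (⋀[R]^j M)).toLinearMap =
      (pureEquiv R k (ExteriorAlgebra R M)).toLinearMap ∘ₗ (⋀[R]^j M).subtype := by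
    ext w
    simp [pureEquiv_apply]
  rw [wedgePart, ← LinearEquiv.range_comp (pureEquiv R k (⋀[R]^j M)), hnat, LinearMap.range_comp,
    Submodule.range_subtype]

/-- The basis `ε ⊗ (e_{i_1} ∧ ⋯ ∧ e_{i_j})`. -/
def basis {α : Type*} [LinearOrder α] (k : ℕ) (b : Module.Basis α R M) :
    Module.Basis (Finset α) R (ShiftedExt R k M) :=
  b.ExteriorAlgebra.map (pureEquiv R k (ExteriorAlgebra R M))

variable {α : Type*} [LinearOrder α] (k : ℕ) (b : Module.Basis α R M)

theorem basis_apply (s : Finset α) : basis k b s = ε R k ⊗ₜ[R] wedge b s := by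
  rw [basis, Module.Basis.map_apply, pureEquiv_apply, basis_exteriorAlgebra_apply]

theorem wedgePart_eq_span (j : ℕ) :
    wedgePart R k M j = Submodule.span R (basis k b '' {s | s.card = j}) := by
  rw [wedgePart_eq_map_pureEquiv, exteriorPower_eq_span b, Submodule.map_span, ← Set.image_comp]
  congr 2
  ext s
  simp [basis_apply, pureEquiv_apply]

theorem inOp_basis {d : Module.Dual R M} {s : Finset α} {j : α} (hj : j ∈ s)
    (hd : ∀ i ∈ s, i ≠ j → d (b i) = 0) :
    inOp R k d (basis k b s) =
      ((-1) ^ {i ∈ s | j < i}.card * d (b j)) • basis k b (s.erase j) := by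
  rw [basis_apply, basis_apply, inOp, LinearMap.lTensor_tmul, LinearMap.flip_apply,
    contractRight_wedge b hj hd, TensorProduct.tmul_smul]

theorem outOp_neg_basis (d : Module.Dual R M) {s : Finset α}
    (hs : (-1 : R) ^ k = (-1) ^ s.card) :
    outOp R k (-d) (basis k b s) = inOp R k d (basis k b s) := by
  rw [basis_apply, inOp, outOp, LinearMap.smul_apply, LinearMap.lTensor_tmul,
    LinearMap.lTensor_tmul, LinearMap.flip_apply, contractRight_eq_neg_contractLeft_involute,
    involute_wedge, hs, map_smul, map_neg, LinearMap.neg_apply, ← TensorProduct.tmul_smul,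
    smul_neg]

theorem commute_outOp_inOp (d d' : Module.Dual R M) : Commute (outOp R k d) (inOp R k d') := by
  refine TensorProduct.ext' fun a w => ?_
  simp [outOp, inOp, contractRight_contractLeft]

end Pure

section Bimodule

variable {M : Type u} [AddCommGroup M] [Module R M] {p : ℕ} (k : ℕ) (b : Module.Basis (Fin p) R M)
  (d : Fin p → Module.Dual R M)

theorem rightAction_E (j : Fin p) :
    rightAction R k d (GrAlg.E R p j) = MulOpposite.op (inOp R k (d j)) :=
  GrAlg.powLift_incl p _ _ _ j

theorem commute_outOp_rightAction (d' : Module.Dual R M) (x : (GrAlg.dualPow R p).carrier) :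
    Commute (outOp R k d') (rightAction R k d x).unop := by
  let C : Subalgebra R (Module.End R (ShiftedExt R k M))ᵐᵒᵖ :=
    Subalgebra.centralizer R {MulOpposite.op (outOp R k d')}
  have hE : Set.range (GrAlg.E R p) ⊆ C.comap (rightAction R k d) := by
    rintro _ ⟨j, rfl⟩
    rw [SetLike.mem_coe, Subalgebra.mem_comap, rightAction_E]
    exact Subalgebra.mem_centralizer_iff R |>.2 fun _ h =>
      h ▸ (commute_outOp_inOp k d' (d j)).op
  have hx : x ∈ C.comap (rightAction R k d) :=
    Algebra.adjoin_le hE (GrAlg.adjoin_range_E (R := R) p ▸ Algebra.mem_top)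
  exact Commute.unop (Subalgebra.mem_centralizer_iff R |>.1 hx _ rfl)

/-- The map `x ↦ (ε ⊗ (e_1 ∧ ⋯ ∧ e_p)) · x`. -/
def orbitMap : (GrAlg.dualPow R p).carrier →ₗ[R] ShiftedExt R k M :=
  LinearMap.applyₗ (basis k b Finset.univ) ∘ₗ (MulOpposite.opLinearEquiv R).symm.toLinearMap ∘ₗ
    (rightAction R k d).toLinearMap

theorem orbitMap_apply (x : (GrAlg.dualPow R p).carrier) :
    orbitMap k b d x = (rightAction R k d x).unop (basis k b Finset.univ) := rfl

theorem orbitMap_mul (x y : (GrAlg.dualPow R p).carrier) :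
    orbitMap k b d (x * y) = (rightAction R k d y).unop (orbitMap k b d x) := by
  rw [orbitMap_apply, map_mul]
  rfl

variable {d}
variable (hd : ∀ i j, d j (b i) = if i = j then (-1 : R) ^ (p - (j + 1 : ℕ)) else 0)
include hd

theorem inOp_basis_of_Ici_subset {j : Fin p} {s : Finset (Fin p)} (hs : Finset.Ici j ⊆ s) :
    inOp R k (d j) (basis k b s) = basis k b (s.erase j) := by
  have hcard : {i ∈ s | j < i}.card = p - (j + 1) := by
    have hIoi : {i ∈ s | j < i} = Finset.Ioi j := by
      ext i
      simpa using fun h : j < i => hs (Finset.mem_Ici.2 h.le)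
    rw [hIoi, Fin.card_Ioi, Nat.sub_sub, add_comm]
  rw [inOp_basis k b (hs (Finset.mem_Ici.2 le_rfl)) fun i _ hi => by rw [hd, if_neg hi], hcard, hd,
    if_pos rfl, ← mul_pow, neg_one_mul, neg_neg, one_pow, one_smul]

theorem rightAction_prod_basis {l : List (Fin p)} (hl : l.SortedLT) {s : Finset (Fin p)}
    (hs : ∀ j ∈ l, Finset.Ici j ⊆ s) :
    (rightAction R k d (l.map (GrAlg.E R p)).prod).unop (basis k b s) =
      basis k b (s \ l.toFinset) := by
  induction l generalizing s with
  | nil => simp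
  | cons j l ih =>
    obtain ⟨hj, hl⟩ := List.pairwise_cons.1 hl.pairwise
    obtain ⟨hjs, hs⟩ := List.forall_mem_cons.1 hs
    have hs' (i) (hi : i ∈ l) : Finset.Ici i ⊆ s.erase j := fun a ha =>
      Finset.mem_erase.2 ⟨((hj i hi).trans_le (Finset.mem_Ici.1 ha)).ne', hs i hi ha⟩
    rw [List.map_cons, List.prod_cons, map_mul, MulOpposite.unop_mul, Module.End.mul_apply,
      rightAction_E, MulOpposite.unop_op, inOp_basis_of_Ici_subset k b hd hjs, ih hl.sortedLT hs',
      List.toFinset_cons, Finset.sdiff_insert, Finset.erase_sdiff_comm]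

theorem orbitMap_prodE (s : Finset (Fin p)) :
    orbitMap k b d (GrAlg.prodE R p s) = basis k b sᶜ := by
  rw [orbitMap_apply, GrAlg.prodE, rightAction_prod_basis k b hd (Finset.sortedLT_sort s)
    fun _ _ => Finset.subset_univ _, Finset.sort_toFinset, Finset.compl_eq_univ_sdiff]

/-- The bimodule isomorphism `ε ⊗ (e_{i_1} ∧ ⋯ ∧ e_{i_k}) ↦ E_{j_1} ⋯ E_{j_{p-k}}`. -/
def bimoduleEquiv : ShiftedExt R k M ≃ₗ[R] (GrAlg.dualPow R p).carrier :=
  LinearEquiv.ofLinearMap ((basis k b).constr R fun s => GrAlg.prodE R p sᶜ) (orbitMap k b d)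
    (LinearMap.ext_on_range (GrAlg.span_range_prodE p) fun s => by
      rw [LinearMap.comp_apply, orbitMap_prodE k b hd, Module.Basis.constr_basis, compl_compl,
        LinearMap.id_apply])
    ((basis k b).ext fun s => by
      rw [LinearMap.comp_apply, Module.Basis.constr_basis, orbitMap_prodE k b hd, compl_compl,
        LinearMap.id_apply])

theorem bimoduleEquiv_basis (s : Finset (Fin p)) :
    bimoduleEquiv k b hd (basis k b s) = GrAlg.prodE R p sᶜ :=
  (basis k b).constr_basis R _ s

theorem bimoduleEquiv_orbitMap (x : (GrAlg.dualPow R p).carrier) :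
    bimoduleEquiv k b hd (orbitMap k b d x) = x :=
  (bimoduleEquiv k b hd).apply_symm_apply x

theorem exists_orbitMap_eq (z : ShiftedExt R k M) : ∃ x, orbitMap k b d x = z :=
  (bimoduleEquiv k b hd).symm.surjective z

theorem bimoduleEquiv_rightAction (z : ShiftedExt R k M) (x : (GrAlg.dualPow R p).carrier) :
    bimoduleEquiv k b hd ((rightAction R k d x).unop z) = bimoduleEquiv k b hd z * x := by
  obtain ⟨y, rfl⟩ := exists_orbitMap_eq k b hd z
  rw [← orbitMap_mul, bimoduleEquiv_orbitMap, bimoduleEquiv_orbitMap]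

omit hd in
theorem outOp_neg_sum_basis_univ (hk : (-1 : R) ^ k = (-1) ^ p) :
    outOp R k (-∑ j, d j) (basis k b Finset.univ) =
      orbitMap k b d (GrAlg.iterCoproduct p DualNumber.eps) := by
  have hE (j : Fin p) :
      orbitMap k b d (GrAlg.E R p j) = inOp R k (d j) (basis k b Finset.univ) := by
    rw [orbitMap_apply, rightAction_E, MulOpposite.unop_op]
  have hsum : inOp R k (∑ j, d j) = ∑ j, inOp R k (d j) := by
    refine TensorProduct.ext' fun a w => ?_
    simp [inOp, TensorProduct.tmul_sum]
  rw [outOp_neg_basis k b _ (by rw [hk, Finset.card_univ, Fintype.card_fin]),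
    GrAlg.iterCoproduct_eps, map_sum, Finset.sum_congr rfl fun j _ => hE j, hsum,
    LinearMap.sum_apply]

theorem bimoduleEquiv_outOp (hk : (-1 : R) ^ k = (-1) ^ p) (z : ShiftedExt R k M) :
    bimoduleEquiv k b hd (outOp R k (-∑ j, d j) z) =
      GrAlg.iterCoproduct p DualNumber.eps * bimoduleEquiv k b hd z := by
  obtain ⟨x, rfl⟩ := exists_orbitMap_eq k b hd z
  have hcomm := LinearMap.congr_fun (commute_outOp_rightAction k d (-∑ j, d j) x).eq
    (basis k b Finset.univ)
  rw [Module.End.mul_apply, Module.End.mul_apply, outOp_neg_sum_basis_univ k b hk,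
    ← orbitMap_apply, ← orbitMap_mul] at hcomm
  rw [hcomm, bimoduleEquiv_orbitMap, bimoduleEquiv_orbitMap]

theorem bimoduleEquiv_leftAction (hk : (-1 : R) ^ k = (-1) ^ p) {d' : Fin 1 → Module.Dual R M}
    (hd' : d' 0 = -∑ j, d j) (a : DualNumber R) (z : ShiftedExt R k M) :
    bimoduleEquiv k b hd (leftAction R k d' (GrAlg.incl 1 0 a) z) =
      GrAlg.iterCoproduct p a * bimoduleEquiv k b hd z := by
  have hE : leftAction R k d' (GrAlg.incl 1 0 DualNumber.eps) = outOp R k (-∑ j, d j) :=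
    hd' ▸ GrAlg.powLift_incl 1 _ _ _ 0
  rw [GrAlg.eq_fst_smul_one_add_snd_smul_eps a]
  simp only [map_add, map_smul, map_one, LinearMap.add_apply, LinearMap.smul_apply, add_mul,
    smul_mul_assoc, GrAlg.iterCoproduct_one, one_mul, Module.End.one_apply]
  rw [hE, bimoduleEquiv_outOp k b hd hk]

end Bimodule

end ShiftedExt

namespace SingularRel

section Cone

variable {X : Type u} [TopologicalSpace X]

theorem stdSimplex_map_apply {m n : ℕ} (f : Fin m → Fin n) (s : stdSimplex ℝ (Fin m))
    (j : Fin n) : stdSimplex.map f s j = ∑ i, if f i = j then s i else 0 := by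
  rw [stdSimplex.map_coe, FunOnFinite.linearMap_apply_apply, Finset.sum_filter]

/-- The parametrisation of `Δⁿ⁺¹` as the join of its vertex `0`, reached at time `1`, with the
opposite face `Δⁿ`, which is the slice at time `0`. -/
def joinVertex (n : ℕ) : C(stdSimplex ℝ (Fin (n + 1)) × unitInterval,
    stdSimplex ℝ (Fin (n + 2))) where
  toFun q := ⟨Fin.cons (q.2 : ℝ) fun i => (1 - q.2) * q.1 i, by
    refine ⟨Fin.cases q.2.2.1 fun i => mul_nonneg (sub_nonneg.2 q.2.2.2) (q.1.2.1 i), ?_⟩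
    simp_rw [Fin.sum_univ_succ (n := n + 1), Fin.cons_zero, Fin.cons_succ, ← Finset.mul_sum,
      stdSimplex.sum_eq_one]
    ring⟩
  continuous_toFun := by
    have h (i) : Continuous fun q : stdSimplex ℝ (Fin (n + 1)) × unitInterval => q.1 i :=
      (continuous_apply i).comp (continuous_subtype_val.comp continuous_fst)
    refine Continuous.subtype_mk (continuous_pi (Fin.cases ?_ fun i => ?_)) _
    · exact continuous_subtype_val.comp continuous_snd
    · exact (continuous_const.sub (continuous_subtype_val.comp continuous_snd)).mul (h i)

theorem joinVertex_surjective (n : ℕ) : Function.Surjective (joinVertex n) := by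
  intro u
  have hu : ∑ i : Fin (n + 1), u i.succ = 1 - u 0 := by
    rw [eq_sub_iff_add_eq', ← Fin.sum_univ_succ, stdSimplex.sum_eq_one]
  have h1 : 0 ≤ 1 - u 0 := sub_nonneg.2 (stdSimplex.le_one u 0)
  rcases h1.eq_or_lt' with h0 | h0
  · have h (i : Fin (n + 1)) : u i.succ = 0 := (Finset.sum_eq_zero_iff_of_nonneg
      fun i _ => stdSimplex.zero_le u _).1 (hu.trans h0) i (Finset.mem_univ _)
    refine ⟨(stdSimplex.vertex 0, 1), stdSimplex.ext (funext (Fin.cases ?_ fun i => ?_))⟩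
    · exact sub_eq_zero.1 h0
    · exact (by simp : (1 - ((1 : unitInterval) : ℝ)) * _ = 0).trans (h i).symm
  · refine ⟨(⟨fun i => u i.succ / (1 - u 0), fun i => div_nonneg (stdSimplex.zero_le u _) h1, ?_⟩,
      ⟨u 0, stdSimplex.zero_le u 0, stdSimplex.le_one u 0⟩),
      stdSimplex.ext (funext (Fin.cases rfl fun i => ?_))⟩
    · rw [← Finset.sum_div, hu, div_self h0.ne']
    · exact mul_div_cancel₀ _ h0.ne'

theorem joinVertex_apply_zero {n : ℕ} (q : stdSimplex ℝ (Fin (n + 1)) × unitInterval) :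
    joinVertex n q 0 = q.2 := rfl

theorem joinVertex_apply_succ {n : ℕ} (q : stdSimplex ℝ (Fin (n + 1)) × unitInterval)
    (i : Fin (n + 1)) : joinVertex n q i.succ = (1 - q.2) * q.1 i := rfl

theorem joinVertex_zero (n : ℕ) (s : stdSimplex ℝ (Fin (n + 1))) :
    joinVertex n (s, 0) = stdSimplex.map (Fin.succAbove 0) s := by
  refine stdSimplex.ext (funext fun j => ?_)
  rw [stdSimplex_map_apply]
  induction j using Fin.cases with
  | zero => simp [joinVertex_apply_zero]
  | succ j => simp [joinVertex_apply_succ]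

theorem map_succAbove_joinVertex (n : ℕ) (i : Fin (n + 2)) (s : stdSimplex ℝ (Fin (n + 1)))
    (t : unitInterval) : stdSimplex.map i.succ.succAbove (joinVertex n (s, t)) =
      joinVertex (n + 1) (stdSimplex.map i.succAbove s, t) := by
  refine stdSimplex.ext (funext fun j => ?_)
  rw [stdSimplex_map_apply, Fin.sum_univ_succ]
  induction j using Fin.cases with
  | zero => simp [joinVertex_apply_zero]
  | succ j =>
    rw [joinVertex_apply_succ, stdSimplex_map_apply, Finset.mul_sum]
    simp [joinVertex_apply_succ, eq_comm (a := (0 : Fin (n + 3)))]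

theorem isQuotientMap_joinVertex (n : ℕ) : Topology.IsQuotientMap (joinVertex n) :=
  .of_surjective_continuous (joinVertex_surjective n) (joinVertex n).continuous

variable {x₀ : X} (F : (ContinuousMap.id X).Homotopy (ContinuousMap.const X x₀))

theorem contraction_factorsThrough_joinVertex {n : ℕ} (σ : Simplex n X) :
    Function.FactorsThrough (fun q => F (q.2, σ q.1)) (joinVertex n) := by
  rintro ⟨s, t⟩ ⟨s', t'⟩ h
  have h0 : (t : ℝ) = t' := congrArg (· 0) h
  obtain rfl := Subtype.ext h0
  rcases eq_or_ne t 1 with rfl | h1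
  · simp only [F.apply_one, ContinuousMap.const_apply]
  · have hs : s = s' := stdSimplex.ext (funext fun i => mul_left_cancel₀
      (sub_ne_zero.2 fun h => h1 (Subtype.ext h.symm)) (congrArg (· i.succ) h))
    rw [hs]

/-- The cone over a singular simplex along a contraction of the space, with apex at vertex `0`. -/
def cone {n : ℕ} (σ : Simplex n X) : Simplex (n + 1) X :=
  (isQuotientMap_joinVertex n).lift ⟨fun q => F (q.2, σ q.1), by fun_prop⟩
    (contraction_factorsThrough_joinVertex F σ)

theorem cone_joinVertex {n : ℕ} (σ : Simplex n X) (s : stdSimplex ℝ (Fin (n + 1)))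
    (t : unitInterval) : cone F σ (joinVertex n (s, t)) = F (t, σ s) :=
  DFunLike.congr_fun (Topology.IsQuotientMap.lift_comp (isQuotientMap_joinVertex n)
    ⟨fun q => F (q.2, σ q.1), by fun_prop⟩ (contraction_factorsThrough_joinVertex F σ)) (s, t)

theorem face_zero_cone {n : ℕ} (σ : Simplex n X) : face n 0 (cone F σ) = σ := by
  ext s
  change cone F σ (stdSimplex.map (Fin.succAbove 0) s) = σ s
  rw [← joinVertex_zero, cone_joinVertex]
  exact F.apply_zero _

theorem face_succ_cone {n : ℕ} (i : Fin (n + 2)) (σ : Simplex (n + 1) X) :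
    face (n + 1) i.succ (cone F σ) = cone F (face n i σ) := by
  ext u
  obtain ⟨⟨s, t⟩, rfl⟩ := joinVertex_surjective n u
  change cone F σ (stdSimplex.map i.succ.succAbove (joinVertex n (s, t))) = _
  rw [map_succAbove_joinVertex, cone_joinVertex, cone_joinVertex]
  rfl

variable (R : Type) [CommRing R]

/-- The linear extension of `cone` to chains. -/
def coneChain (n : ℕ) : Chain R n X →ₗ[R] Chain R (n + 1) X :=
  Finsupp.lmapDomain R R (cone F)

theorem coneChain_single {n : ℕ} (σ : Simplex n X) (r : R) :
    coneChain F R n (Finsupp.single σ r) = Finsupp.single (cone F σ) r :=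
  Finsupp.mapDomain_single

theorem boundary_coneChain_add (n : ℕ) (c : Chain R (n + 1) X) :
    boundary R (n + 1) (coneChain F R (n + 1) c) + coneChain F R n (boundary R n c) = c := by
  induction c using Finsupp.induction_linear with
  | zero => simp only [map_zero, add_zero]
  | add c d hc hd =>
    nth_rewrite 3 [← hc, ← hd]
    simp only [map_add]
    abel
  | single σ r =>
    rw [← mul_one r, ← smul_eq_mul, ← Finsupp.smul_single]
    simp only [map_smul, ← smul_add]
    congr 1
    simp only [coneChain_single, boundary_single, map_sum, Fin.sum_univ_succ (n := n + 2),
      face_zero_cone, face_succ_cone, Fin.val_zero, Fin.val_succ, pow_zero, pow_succ, mul_neg_one,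
      Finsupp.single_neg, Finset.sum_neg_distrib, neg_add_cancel_right]

end Cone

variable {X : Type u} [TopologicalSpace X] (R : Type) [CommRing R]

theorem exists_boundary_eq [ContractibleSpace X] {n : ℕ} {c : Chain R (n + 1) X}
    (hc : boundary R n c = 0) : ∃ b, boundary R (n + 1) b = c := by
  obtain ⟨x₀, ⟨F⟩⟩ := id_nullhomotopic X
  have h := boundary_coneChain_add F R n c
  rw [hc, map_zero, add_zero] at h
  exact ⟨_, h⟩

/-- A point as a singular `0`-chain. -/
def pointChain (x : X) : Chain R 0 X := Finsupp.single (ContinuousMap.const _ x) 1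

theorem single_eq_pointChain (σ : Simplex 0 X) :
    Finsupp.single σ 1 = pointChain R (σ default) := by
  refine congrArg (Finsupp.single · 1) (ContinuousMap.ext fun t => ?_)
  rw [Subsingleton.elim t default, ContinuousMap.const_apply]

theorem chainsIn_zero (S : Set X) :
    chainsIn R 0 S = Submodule.span R (Set.range fun x : S => pointChain R (x : X)) := by
  refine congrArg (Submodule.span R) (Set.ext fun c => ⟨?_, ?_⟩)
  · rintro ⟨σ, hσ, rfl⟩
    exact ⟨⟨σ default, hσ ⟨_, rfl⟩⟩, (single_eq_pointChain R σ).symm⟩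
  · rintro ⟨x, rfl⟩
    exact ⟨_, Set.range_subset_iff.2 fun _ => x.2, rfl⟩

theorem boundary_single_eq_sub (σ : Simplex 1 X) : boundary R 0 (Finsupp.single σ 1) =
    pointChain R (σ (stdSimplex.vertex 1)) - pointChain R (σ (stdSimplex.vertex 0)) := by
  have hface (i : Fin 2) : face 0 i σ default = σ (stdSimplex.vertex (i.succAbove 0)) := by
    rw [show (default : stdSimplex ℝ (Fin 1)) = stdSimplex.vertex 0 from Subsingleton.elim _ _]
    simp [face]
  simp [boundary_single, Fin.sum_univ_two, single_eq_pointChain, hface, sub_eq_add_neg]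

theorem boundary_pathSimplex {x y : X} (γ : Path x y) :
    boundary R 0 (Finsupp.single (pathSimplex γ) 1) = pointChain R y - pointChain R x := by
  simp [boundary_single_eq_sub, pathSimplex]

theorem pointChain_sub_mem_map_boundary {S : Set X} {x y : S} (h : Joined x y) :
    pointChain R (y : X) - pointChain R (x : X) ∈ (chainsIn R 1 S).map (boundary R 0) := by
  obtain ⟨γ⟩ := h
  refine ⟨_, Submodule.subset_span ⟨pathSimplex (γ.map continuous_subtype_val), ?_, rfl⟩,
    boundary_pathSimplex R _⟩
  exact Set.range_subset_iff.2 fun t => (γ _).2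

open Classical in
theorem countIn_pointChain (T : Set X) (x : X) :
    countIn R T (pointChain R x) = if x ∈ T then 1 else 0 :=
  countIn_single R T _ 1

theorem countIn_univ_boundary (c : Chain R 1 X) : countIn R Set.univ (boundary R 0 c) = 0 := by
  have h : countIn (X := X) R Set.univ ∘ₗ boundary R 0 = 0 := by
    ext σ
    simp [boundary_single_eq_sub, countIn_pointChain]
  exact LinearMap.congr_fun h c

open Classical in
theorem countIn_componentSet_pointChain {S : Set X} (I : ConnectedComponents S) (x : S) :
    countIn R (componentSet I) (pointChain R (x : X)) =
      if ConnectedComponents.mk x = I then 1 else 0 := by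
  rw [countIn_pointChain]
  exact if_congr ⟨fun ⟨_, h⟩ => h, fun h => ⟨x.2, h⟩⟩ rfl rfl

theorem sum_countIn_componentSet {S : Set X} [Fintype (ConnectedComponents S)] {c : Chain R 0 X}
    (hc : c ∈ chainsIn R 0 S) :
    ∑ I : ConnectedComponents S, countIn R (componentSet I) c = countIn R Set.univ c := by
  classical
  rw [chainsIn_zero] at hc
  rw [← LinearMap.sum_apply]
  refine LinearMap.eqOn_span ?_ hc
  rintro _ ⟨x, rfl⟩
  simp_rw [LinearMap.sum_apply, countIn_componentSet_pointChain]
  simp [countIn_pointChain]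

theorem mem_map_boundary_of_countIn_eq_zero {S : Set X} [LocallyPathConnectedSpace S]
    {c : Chain R 0 X} (hc : c ∈ chainsIn R 0 S)
    (h0 : ∀ I : ConnectedComponents S, countIn R (componentSet I) c = 0) :
    c ∈ (chainsIn R 1 S).map (boundary R 0) := by
  classical
  rw [chainsIn_zero, Finsupp.mem_span_range_iff_exists_finsupp] at hc
  obtain ⟨a, rfl⟩ := hc
  choose base hbase using ConnectedComponents.surjective_coe (α := S)
  set B := (chainsIn R 1 S).map (boundary R 0)
  have hclass (x : S) : B.mkQ (pointChain R (x : X)) = B.mkQ (pointChain R (base x : X)) :=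
    (Submodule.Quotient.eq B).2 (pointChain_sub_mem_map_boundary R
      ((connectedComponent_eq_iff_joined _ _).1 (ConnectedComponents.coe_eq_coe.1 (hbase x))))
  have ha : a.mapDomain ConnectedComponents.mk = 0 := by
    ext I
    rw [Finsupp.zero_apply, ← h0 I, map_finsuppSum, Finsupp.mapDomain, Finsupp.sum_apply]
    simp only [map_smul, countIn_componentSet_pointChain, Finsupp.single_apply, smul_eq_mul,
      mul_ite, mul_one, mul_zero]
  rw [← Submodule.ker_mkQ B, LinearMap.mem_ker, map_finsuppSum]
  calc a.sum (fun x r => B.mkQ (r • pointChain R (x : X)))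
      = a.sum fun x r => r • B.mkQ (pointChain R (base x : X)) :=
        Finsupp.sum_congr fun x _ => (map_smul _ _ _).trans (congrArg _ (hclass x))
    _ = (a.mapDomain ConnectedComponents.mk).sum fun I r =>
          r • B.mkQ (pointChain R (base I : X)) :=
        (Finsupp.sum_mapDomain_index (h := fun I r => r • B.mkQ (pointChain R (base I : X)))
          (fun _ => zero_smul R _) fun _ _ _ => add_smul _ _ _).symm
    _ = 0 := by rw [ha, Finsupp.sum_zero_index]

theorem eq_zero_of_dualClass_connecting [ContractibleSpace X] {S : Set X}
    [LocallyPathConnectedSpace S] {z : H1 R S}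
    (hz : ∀ I : ConnectedComponents S, dualClass R I (connecting R S z) = 0) : z = 0 := by
  obtain ⟨_, c, hc, rfl⟩ := z
  obtain ⟨c', hc', hcc'⟩ := mem_map_boundary_of_countIn_eq_zero R hc hz
  obtain ⟨b, hb⟩ := exists_boundary_eq R (c := c - c') (by rw [map_sub, hcc', sub_self])
  refine Subtype.ext ((Submodule.Quotient.mk_eq_zero _).2 ?_)
  rw [← sub_add_cancel c c', ← hb]
  exact Submodule.add_mem_sup ⟨b, rfl⟩ hc'

theorem sum_dualClass_connecting {S : Set X} [Fintype (ConnectedComponents S)] (z : H1 R S) :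
    ∑ I : ConnectedComponents S, dualClass R I (connecting R S z) = 0 := by
  obtain ⟨_, c, hc, rfl⟩ := z
  exact (sum_countIn_componentSet R hc).trans (countIn_univ_boundary R c)

open Classical in
theorem dualClass_connecting_arcClass {S : Set X} {I J K : ConnectedComponents S} {x y : X}
    (γ : Path x y) (hx : x ∈ componentSet J) (hy : y ∈ componentSet K) :
    dualClass R I (connecting R S (arcClass R γ hx.1 hy.1)) =
      (if K = I then 1 else 0) - if J = I then 1 else 0 := by
  change countIn R (componentSet I) (boundary R 0 (Finsupp.single (pathSimplex γ) 1)) = _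
  obtain ⟨hx, rfl⟩ := hx
  obtain ⟨hy, rfl⟩ := hy
  rw [boundary_pathSimplex, map_sub, ← countIn_componentSet_pointChain R,
    ← countIn_componentSet_pointChain R]

end SingularRel

theorem not_isCompact_connectedComponent {X Y : Type*} [TopologicalSpace X] [TopologicalSpace Y]
    [LocallyConnectedSpace Y] [T2Space X] [PreconnectedSpace X] {f : Y → X} (hc : Continuous f)
    (ho : IsOpenMap f) (hs : ¬ Function.Surjective f) (y : Y) :
    ¬ IsCompact (connectedComponent y) := by
  intro hy
  have himage : f '' connectedComponent y = Set.univ :=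
    IsClopen.eq_univ ⟨(hy.image hc).isClosed, ho _ isOpen_connectedComponent⟩
      ⟨f y, y, mem_connectedComponent, rfl⟩
  exact hs (Set.range_eq_univ.1 (Set.eq_univ_of_univ_subset
    (himage ▸ Set.image_subset_range f _)))

namespace SingularRel

theorem componentSet_eq_image {X : Type*} [TopologicalSpace X] {S : Set X} (y : S) :
    componentSet (ConnectedComponents.mk y) = (↑) '' connectedComponent y := by
  rw [← connectedComponents_preimage_singleton]
  ext x
  simp [componentSet]

end SingularRel

namespace Disk

instance : ContractibleSpace D :=
  (convex_closedBall (0 : ℂ) 1).contractibleSpace (Metric.nonempty_closedBall.2 zero_le_one)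

theorem minus_nonempty (p : ℕ) : (minus p).Nonempty := by
  have hangle : ((p : ℝ) + 1) * (Real.pi / (p + 1)) = Real.pi := by field_simp
  refine ⟨rot (center p 0) (Real.pi / (p + 1)), (norm_rot _ _).trans (center_mem p 0).1, ?_⟩
  rw [height_rot, neg_center_pow, hangle, one_mul, Complex.exp_pi_mul_I]
  simp

/-- The inclusion of the positive boundary of the disk into the unit circle. -/
def plusToCircle (p : ℕ) (z : plus p) : Circle := ⟨(z : D), mem_sphere_zero_iff_norm.2 z.2.1⟩

theorem range_plusToCircle (p : ℕ) :
    Set.range (plusToCircle p) = {w : Circle | 0 < ((-(w : ℂ)) ^ (p + 1)).re} := by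
  ext w
  constructor
  · rintro ⟨z, rfl⟩
    exact z.2.2
  · exact fun hw => ⟨⟨⟨w, mem_closedBall_zero_iff.2 w.norm_coe.le⟩, w.norm_coe, hw⟩, rfl⟩

theorem isOpenEmbedding_plusToCircle (p : ℕ) : Topology.IsOpenEmbedding (plusToCircle p) := by
  have hval : Topology.IsEmbedding fun z : plus p => ((z : D) : ℂ) :=
    Topology.IsEmbedding.subtypeVal.comp Topology.IsEmbedding.subtypeVal
  refine ⟨.of_comp (hval.continuous.subtype_mk _) continuous_subtype_val hval, ?_⟩
  rw [range_plusToCircle]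
  exact isOpen_lt continuous_const (by fun_prop)

theorem not_surjective_plusToCircle (p : ℕ) : ¬ Function.Surjective (plusToCircle p) := by
  intro h
  obtain ⟨z, hz⟩ := minus_nonempty p
  obtain ⟨x, hx⟩ := h ⟨z, mem_sphere_zero_iff_norm.2 hz.1⟩
  have hxz : (x : D) = z := Subtype.ext (congrArg (fun w : Circle => (w : ℂ)) hx)
  exact lt_asymm (hxz ▸ x.2.2) hz.2

end Disk

namespace SuturedSurface

open SingularRel

section Surface

variable {m n : ℕ} (F : SuturedSurface.{u} m n)

theorem meets [PreconnectedSpace F.carrier] (C : ConnectedComponents F.carrier)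
    {T : Set F.carrier} (hT : T.Nonempty) : F.Meets C T :=
  hT.imp fun _ hx => ⟨hx, Subsingleton.elim _ _⟩

theorem numNoMinus_eq_zero_of_nonempty [PreconnectedSpace F.carrier]
    (h : F.Sminus.Nonempty) : F.numNoMinus = 0 := by
  simp [numNoMinus, F.meets _ h]

theorem numClosed_eq_zero_of_nonempty [PreconnectedSpace F.carrier]
    (h : F.Sminus.Nonempty) : F.numClosed = 0 := by
  have hbdry : F.bdry.Nonempty := h.mono fun x hx =>
    (F.union ▸ Set.mem_union_right F.Splus hx : x ∈ F.bdry \ F.Λ).1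
  simp [numClosed, F.meets _ hbdry]

theorem numCircles_eq_zero_of_not_surjective [LocallyConnectedSpace F.Splus]
    {f : F.Splus → Circle} (hc : Continuous f) (ho : IsOpenMap f)
    (hs : ¬ Function.Surjective f) : F.numCircles = 0 := by
  have hcircle (I : ConnectedComponents F.Splus) : ¬ F.IsCircle I := by
    obtain ⟨y, rfl⟩ := ConnectedComponents.surjective_coe I
    rintro ⟨g⟩
    refine not_isCompact_connectedComponent hc ho hs y (Subtype.isCompact_iff.2 ?_)
    rw [← componentSet_eq_image, isCompact_iff_compactSpace]
    exact g.symm.compactSpace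
  simp [numCircles, hcircle]

end Surface

section Pants

variable {p : ℕ} {P : SuturedSurface.{u} p 1} (ψ : SuturedSurface.Iso P (openPants p))

namespace Iso

/-- The homeomorphism from an open `p`-tuple of pants to the disk. -/
def toDisk : P.carrier ≃ₜ Disk.D := ψ.diffeo.toHomeomorph

/-- The restriction of `toDisk` to the positive boundaries. -/
def plusHomeo : P.Splus ≃ₜ Disk.plus p :=
  ψ.toDisk.subtype fun x => by
    rw [← show ψ.toDisk '' P.Splus = Disk.plus p from ψ.map_plus,
      ψ.toDisk.injective.mem_set_image]

/-- The positive boundary of an open `p`-tuple of pants as an open part of the circle. -/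
def plusToCircle (x : P.Splus) : Circle := Disk.plusToCircle p (ψ.plusHomeo x)

theorem isOpenEmbedding_plusToCircle : Topology.IsOpenEmbedding ψ.plusToCircle :=
  (Disk.isOpenEmbedding_plusToCircle p).comp ψ.plusHomeo.isOpenEmbedding

theorem not_surjective_plusToCircle : ¬ Function.Surjective ψ.plusToCircle :=
  fun h => Disk.not_surjective_plusToCircle p h.of_comp

end Iso

namespace IsOpenPants

theorem contractibleSpace (hP : P.IsOpenPants) : ContractibleSpace P.carrier :=
  let ⟨ψ⟩ := hP
  ψ.toDisk.contractibleSpace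

theorem locallyPathConnectedSpace (hP : P.IsOpenPants) : LocallyPathConnectedSpace P.Splus :=
  let ⟨ψ⟩ := hP
  have : LocallyPathConnectedSpace Circle :=
    ChartedSpace.locallyPathConnectedSpace (EuclideanSpace ℝ (Fin 1)) Circle
  ψ.isOpenEmbedding_plusToCircle.locallyPathConnectedSpace

theorem nonempty_sminus (hP : P.IsOpenPants) : P.Sminus.Nonempty := by
  obtain ⟨ψ⟩ := hP
  have h : (ψ.diffeo '' P.Sminus).Nonempty := ψ.map_minus.symm ▸ Disk.minus_nonempty p
  exact h.of_image

theorem numNoMinus_eq_zero (hP : P.IsOpenPants) : P.numNoMinus = 0 :=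
  have := hP.contractibleSpace
  P.numNoMinus_eq_zero_of_nonempty hP.nonempty_sminus

theorem numClosed_eq_zero (hP : P.IsOpenPants) : P.numClosed = 0 :=
  have := hP.contractibleSpace
  P.numClosed_eq_zero_of_nonempty hP.nonempty_sminus

theorem numCircles_eq_zero (hP : P.IsOpenPants) : P.numCircles = 0 := by
  have := hP.locallyPathConnectedSpace
  obtain ⟨ψ⟩ := hP
  exact P.numCircles_eq_zero_of_not_surjective ψ.isOpenEmbedding_plusToCircle.continuous
    ψ.isOpenEmbedding_plusToCircle.isOpenMap ψ.not_surjective_plusToCircle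

end IsOpenPants

end Pants

variable (R : Type) [CommRing R] {m n : ℕ}

theorem gr_eq_span {α : Type*} [LinearOrder α] (F : SuturedSurface.{u} m n)
    (b : Module.Basis α R (F.H R)) (N : Fin 4 → ZMod 2) (A : Fin 4 → ℚ) (q : ℚ) (a : ZMod 2) :
    F.gr R N A q a = Submodule.span R (ShiftedExt.basis (F.parity N).val b ''
      {s | (s.card : ℚ) + F.δ A = q ∧ (s.card : ZMod 2) + F.parity N = a}) := by
  simp_rw [gr, ShiftedExt.wedgePart_eq_span (F.parity N).val b]
  exact iSup_span_image_fiber _ Finset.card _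

variable (F : SuturedSurface.{u} m 1)

theorem φ_out_eq_neg_sum : F.φ R (F.out 0) = -∑ j, F.φ R (F.inc j) := by
  have := Fintype.ofBijective _ F.label_bijective
  ext z
  have hsum := sum_dualClass_connecting R z
  rw [← (Equiv.ofBijective _ F.label_bijective).sum_comp, Fintype.sum_sum_type,
    Fin.sum_univ_one] at hsum
  rw [LinearMap.neg_apply, LinearMap.sum_apply]
  exact eq_neg_of_add_eq_zero_right hsum

theorem eq_zero_of_φ_inc [ContractibleSpace F.carrier] [LocallyPathConnectedSpace F.Splus]
    {z : F.H R} (hz : ∀ j, F.φ R (F.inc j) z = 0) : z = 0 := by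
  refine eq_zero_of_dualClass_connecting R fun I => ?_
  obtain ⟨j | i, rfl⟩ := F.label_bijective.2 I
  · exact hz j
  · rw [Subsingleton.elim i 0]
    refine (LinearMap.congr_fun (F.φ_out_eq_neg_sum R) z).trans ?_
    rw [LinearMap.neg_apply, LinearMap.sum_apply, Finset.sum_eq_zero fun j _ => hz j, neg_zero]

end SuturedSurface

namespace PantsArcs

open SingularRel

variable (R : Type) [CommRing R] {p : ℕ} {P : SuturedSurface.{u} p 1} (γ : PantsArcs P)

theorem φ_inc_e (i j : Fin p) :
    P.φ R (P.inc j) (γ.e R i) = if i = j then (-1 : R) ^ (p - (j + 1 : ℕ)) else 0 := by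
  classical
  have hinc : P.inc i = P.inc j ↔ i = j :=
    ⟨fun h => Sum.inl_injective (P.label_bijective.1 h), congrArg _⟩
  have hout : P.out 0 ≠ P.inc j := fun h => Sum.inr_ne_inl (P.label_bijective.1 h)
  rw [e, SuturedSurface.φ, LinearMap.comp_apply]
  split_ifs with heven hij hij
  · rw [dualClass_connecting_arcClass R _ (γ.left_mem i) (γ.right_mem i), if_neg hout,
      if_pos (hinc.2 hij), ← hij, heven.neg_one_pow, sub_zero]
  · rw [dualClass_connecting_arcClass R _ (γ.left_mem i) (γ.right_mem i), if_neg hout,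
      if_neg (mt hinc.1 hij), sub_zero]
  · rw [dualClass_connecting_arcClass R _ (γ.right_mem i) (γ.left_mem i), if_neg hout,
      if_pos (hinc.2 hij), ← hij, (Nat.not_even_iff_odd.1 heven).neg_one_pow, zero_sub]
  · rw [dualClass_connecting_arcClass R _ (γ.right_mem i) (γ.left_mem i), if_neg hout,
      if_neg (mt hinc.1 hij), sub_zero]

section Basis

variable [ContractibleSpace P.carrier] [LocallyPathConnectedSpace P.Splus]

theorem dualBases :
    Module.DualBases (γ.e R) fun j => (-1 : R) ^ (p - (j + 1 : ℕ)) • P.φ R (P.inc j) where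
  eval_same j := by
    rw [LinearMap.smul_apply, φ_inc_e, if_pos rfl, smul_eq_mul, ← mul_pow, neg_one_mul, neg_neg,
      one_pow]
  eval_of_ne j i h := by
    beta_reduce
    rw [LinearMap.smul_apply, φ_inc_e, if_neg h.symm, smul_zero]
  total h := sub_eq_zero.1 <| P.eq_zero_of_φ_inc R fun j => by
    rw [map_sub, sub_eq_zero]
    exact ((isUnit_one (M := R)).neg.pow _).smul_left_cancel.1 (h j)

/-- The basis `e_1, …, e_p` of `H_1(P, S₊; R)`. -/
def basis : Module.Basis (Fin p) R (P.H R) := (γ.dualBases R).basis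

theorem coe_basis : ⇑(γ.basis R) = γ.e R := (γ.dualBases R).coe_basis

theorem isBasis : γ.IsBasis R := by
  rw [IsBasis, ← coe_basis]
  exact ⟨(γ.basis R).linearIndependent, (γ.basis R).span_eq⟩

include γ in
theorem h_eq : P.h = p := by
  rw [SuturedSurface.h, SuturedSurface.rankH, Module.finrank_eq_card_basis (γ.basis ℤ),
    Fintype.card_fin]

variable (N : Fin 4 → ZMod 2)

/-- The bimodule isomorphism `Z^{S₊}_{δ,π}(P) ≃ (R[E]/(E²))^{⊗p}` determined by the basis `e_i`. -/
def bimoduleEquiv : P.Z R N ≃ₗ[R] (GrAlg.dualPow R p).carrier :=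
  ShiftedExt.bimoduleEquiv (P.parity N).val (γ.basis R) (d := fun j => P.φ R (P.inc j))
    fun i j => by rw [coe_basis, φ_inc_e]

theorem bimoduleEquiv_basis (s : Finset (Fin p)) :
    γ.bimoduleEquiv R N (ShiftedExt.basis (P.parity N).val (γ.basis R) s) = GrAlg.prodE R p sᶜ :=
  ShiftedExt.bimoduleEquiv_basis _ _ _ s

theorem bimoduleEquiv_pureTensor_wedge (s : Finset (Fin p)) :
    γ.bimoduleEquiv R N (P.pureTensor R N (γ.wedge R s)) = GrAlg.prodE R p sᶜ := by
  rw [← γ.bimoduleEquiv_basis R N, ShiftedExt.basis_apply, coe_basis]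
  rfl

theorem bimoduleEquiv_ract (z : P.Z R N) (x : (GrAlg.dualPow R p).carrier) :
    γ.bimoduleEquiv R N (P.ract R N z x) = γ.bimoduleEquiv R N z * x :=
  ShiftedExt.bimoduleEquiv_rightAction _ _ _ z x

theorem bimoduleEquiv_lact (hparity : P.parity N = p) (a : DualNumber R) (z : P.Z R N) :
    γ.bimoduleEquiv R N (P.lact R N (GrAlg.incl 1 0 a) z) =
      GrAlg.iterCoproduct p a * γ.bimoduleEquiv R N z := by
  have hsign : (-1 : R) ^ (P.parity N).val = (-1) ^ p := by
    rw [hparity, ZMod.val_natCast, ← neg_one_pow_eq_pow_mod_two]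
  exact ShiftedExt.bimoduleEquiv_leftAction _ _ _ hsign (P.φ_out_eq_neg_sum R) a z

theorem map_bimoduleEquiv_gr {A : Fin 4 → ℚ} (hδ : P.δ A = -p) (hparity : P.parity N = p)
    (q : ℚ) (a : ZMod 2) :
    (P.gr R N A q a).map (γ.bimoduleEquiv R N).toLinearMap =
      (GrAlg.dualPow R p).superGr q a := by
  have hbasis : γ.bimoduleEquiv R N ∘ ShiftedExt.basis (P.parity N).val (γ.basis R) =
      GrAlg.prodE R p ∘ compl := funext (γ.bimoduleEquiv_basis R N)
  have hcard (s : Finset (Fin p)) : s.card + sᶜ.card = p :=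
    s.card_add_card_compl.trans (Fintype.card_fin p)
  have degree_compl (s : Finset (Fin p)) : (sᶜ.card : ℚ) + P.δ A = -s.card := by
    rw [hδ, ← congrArg Nat.cast (hcard s), Nat.cast_add]
    ring
  have parity_compl (s : Finset (Fin p)) : (sᶜ.card : ZMod 2) + P.parity N = s.card := by
    rw [hparity, ← congrArg Nat.cast (hcard s), Nat.cast_add, add_left_comm,
      CharTwo.add_self_eq_zero, add_zero]
  rw [P.gr_eq_span R (γ.basis R), GrAlg.superGr_dualPow, Submodule.map_span,
    LinearEquiv.coe_coe, ← Set.image_comp, hbasis, Set.image_comp,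
    Set.image_eq_preimage_of_inverse compl_compl compl_compl]
  simp_rw [Set.preimage_ofPred_eq, degree_compl, parity_compl]

end Basis

include γ

theorem δ_eq (hP : P.IsOpenPants) {A : Fin 4 → ℚ} (hA : A 0 = 1) : P.δ A = -p := by
  have := hP.contractibleSpace
  have := hP.locallyPathConnectedSpace
  simp [SuturedSurface.δ, γ.h_eq, hA, hP.numNoMinus_eq_zero, hP.numClosed_eq_zero,
    hP.numCircles_eq_zero]

theorem parity_eq (hP : P.IsOpenPants) {N : Fin 4 → ZMod 2} (hN : N 2 = 0) : P.parity N = p := by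
  have := hP.contractibleSpace
  have := hP.locallyPathConnectedSpace
  simp [SuturedSurface.parity, γ.h_eq, hN, hP.numNoMinus_eq_zero, hP.numClosed_eq_zero,
    hP.numCircles_eq_zero]

end PantsArcs

end

theorem proposition2p7_general (R : Type) [CommRing R] (p : ℕ) (A : Fin 4 → ℚ)
    (N : Fin 4 → ZMod 2) (hA : A 0 = 1) (hN : N 2 = 0) (P : SuturedSurface.{u} p 1)
    (hP : P.IsOpenPants) (γ : PantsArcs P) :
    γ.IsBasis R ∧
    ∃ Φ : P.Z R N ≃+ (GrAlg.dualPow R p).carrier,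
      (∀ s : Finset (Fin p), Φ (P.pureTensor R N (γ.wedge R s)) = GrAlg.prodE R p sᶜ) ∧
      (∀ (q : ℚ) (a : ZMod 2),
        Φ '' (P.gr R N A q a : Set (P.Z R N)) =
          ((GrAlg.dualPow R p).superGr q a : Set (GrAlg.dualPow R p).carrier)) ∧
      (∀ (a : DualNumber R) (z : P.Z R N),
        Φ (P.lact R N (GrAlg.incl 1 0 a) z) = GrAlg.iterCoproduct p a * Φ z) ∧
      (∀ (z : P.Z R N) (b : (GrAlg.dualPow R p).carrier),
        Φ (P.ract R N z b) = Φ z * b) := by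
  have := hP.contractibleSpace
  have := hP.locallyPathConnectedSpace
  have hδ : P.δ A = -p := γ.δ_eq hP hA
  have hparity : P.parity N = p := γ.parity_eq hP hN
  exact ⟨γ.isBasis R, (γ.bimoduleEquiv R N).toAddEquiv, γ.bimoduleEquiv_pureTensor_wedge R N,
    fun q a => congrArg SetLike.coe (γ.map_bimoduleEquiv_gr R N hδ hparity q a),
    γ.bimoduleEquiv_lact R N hparity, γ.bimoduleEquiv_ract R N⟩

theorem proposition2p7 (p : ℕ) (A : Fin 4 → ℚ) (N : Fin 4 → ZMod 2) (hA : A 0 = 1) (hN : N 2 = 0)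
    (P : SuturedSurface.{u} p 1) (hP : P.IsOpenPants) (γ : PantsArcs P) :
    γ.IsBasis ℤ ∧
    ∃ Φ : P.Z ℤ N ≃+ (GrAlg.dualPow ℤ p).carrier,
      (∀ s : Finset (Fin p), Φ (P.pureTensor ℤ N (γ.wedge ℤ s)) = GrAlg.prodE ℤ p sᶜ) ∧
      (∀ (q : ℚ) (a : ZMod 2),
        Φ '' (P.gr ℤ N A q a : Set (P.Z ℤ N)) =
          ((GrAlg.dualPow ℤ p).superGr q a : Set (GrAlg.dualPow ℤ p).carrier)) ∧
      (∀ (a : DualNumber ℤ) (z : P.Z ℤ N),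
        Φ (P.lact ℤ N (GrAlg.incl 1 0 a) z) = GrAlg.iterCoproduct p a * Φ z) ∧
      (∀ (z : P.Z ℤ N) (b : (GrAlg.dualPow ℤ p).carrier),
        Φ (P.ract ℤ N z b) = Φ z * b) :=
  proposition2p7_general ℤ p A N hA hN P hP γ
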